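/- **Coherent sites.** Let $\mathcal C$ be a category with pullbacks and finite coproducts. A coherent site structure on $\mathcal C$ consists of a wide subcategory $\mathcal E$ and, for every object $X$, a collection $\mathcal O_X$ of finite families $\{U_i\to X\}_i$ of $\mathcal E$-morphisms ("coverings"), such that: (a) $\mathcal E$ is closed under isomorphisms and base change, and $\emptyset\to X$ is in $\mathcal E$ for every $X$, where $\emptyset$ is the initial object of $\mathcal C$; (b) every $\mathcal E$-morphism $A\to R$ is monic and flat, i.e. $A\times_R(-)$ preserves finite coproducts; (c) for every finite family $\{U_i\to X\}_i$ of $\mathcal E$-morphisms, $\coprod_{i,j}U_i\times_XU_j\rightrightarrows\coprod_iU_i$ has a coequalizer $Q$ in $\mathcal C$, and the morphisms $U_i\to Q$ are in $\mathcal E$; (d) for every covering $\{U_i\to X\}_i$ the fork $\coprod_{i,j}U_i\times_XU_j\rightrightarrows\coprod_iU_i\to X$ is exact (a coequalizer diagram); (e) $\{\mathrm{id}_X\}\in\mathcal O_X$; a finite set of $\mathcal E$-morphisms over $X$ containing a covering is a covering; coverings are stable under base change; and if $S\in\mathcal O_X$ and $T$ is a finite family of $\mathcal E$-morphisms over $X$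 with $V\times_XT\in\mathcal O_V$ for all $(V\to X)\in S$, then $T\in\mathcal O_X$. **The lattice $\Omega_1(R)$.** For $R\in\mathcal C$, preorder the finite families of $\mathcal E$-morphisms over $R$ by $\{U_i\}_i\prec\{V_j\}_j$ iff $\{U_i\times_RV_j\to U_i\}_j\in\mathcal O_{U_i}$ for all $i$. Let $\Omega_1(R)$ be the associated poset. It is a bounded distributive lattice, with joins given by unions and meets by $\{U_i\times_RV_j\}_{i,j}$, and a morphism $A\to R$ induces $\Omega_1(R)\to\Omega_1(A)$, $\{U_i\}\mapsto\{A\times_RU_i\}$. We assume that every $\Omega_1(R)$ is small (relative to the universe in which the underlying spaces below live). **Weak $\mathcal C$-schemes.** A coherent space is a sober, quasi-compact, quasi-separated topological space $X$ with a basis of quasi-compact opens. Let $\Omega_c(X)$ be its lattice of quasi-compact opens. A $\mathcal C^{op}$-valued sheaf on $X$ is a functor $\mathcal O_X:\Omega_c(X)\to\mathcal C$ such that $\coprod_{i,j}\mathcal O_X(W_i\cap W_j)\rightrightarrows\coprod_i\mathcal O_X(W_i)\to\mathcal O_X(\bigcup_iW_i)$ is exact for every finite family $(W_i)$ in $\Omega_c(X)$.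 Let $\tau_X$ be the sheaf $U\mapsto\Omega_c(U)$ of distributive lattices, and let $\sigma_X$ be the sheafification of $U\mapsto\Omega_1(\mathcal O_X(U))$. A weak $\mathcal C$-scheme is a triple $(X,\mathcal O_X,\beta_X)$, where $X$ is a coherent space, $\mathcal O_X$ is a $\mathcal C^{op}$-valued sheaf on $X$, and $\beta_X:\sigma_X\to\tau_X$ is a morphism of sheaves of distributive lattices, such that for $V\subset U$ in $\Omega_c(X)$ and every $\mathcal E$-morphism $A\to\mathcal O_X(U)$ with $V\subset\beta_X(U)(\{A\to\mathcal O_X(U)\})$, the morphism $\mathcal O_X(V)\to\mathcal O_X(U)$ factors through $A$. A morphism $X\to Y$ is a pair $(f,f^\#)$ of a continuous map $f:X\to Y$ under which inverse images of quasi-compact opens are quasi-compact, and a natural family $f^\#_U:\mathcal O_X(f^{-1}U)\to\mathcal O_Y(U)$, such that $\beta_X(f^{-1}U)\circ\Omega_1(f^\#_U)=f^{-1}\circ\beta_Y(U)$ for all $U\in\Omega_c(Y)$. Let $\Gamma(X)=\mathcal O_X(X)$; this is a functor from weak $\mathcal C$-schemes to $\mathcal C$. **Theorem.** The functor $\Gamma$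 from weak $\mathcal C$-schemes to $\mathcal C$ has a right adjoint $\mathrm{Spec}$, which can be described as follows. 1. The underlying space of $\mathrm{Spec}\,R$ is $\mathrm{Spec}^0R=\mathrm{pt}\,\mathrm{comp}\,\Omega_1(R)$, the space of points of the complete lattice of ideals of $\Omega_1(R)$. Every $a\in\Omega_1(R)$ defines the open set of points $p$ with $p({\downarrow}a)=1$, and this identifies $\Omega_1(R)$ with $\Omega_c(\mathrm{Spec}\,R)$. 2. For $U=\{U_i\to R\}_i$, $\mathcal O(U)$ is the coequalizer of $\coprod_{i,j}U_i\times_RU_j\rightrightarrows\coprod_iU_i$. For $U=\{U_i\}\prec V=\{V_j\}$ the morphism $\mathcal O(U)\to\mathcal O(V)$ is the one induced by the projections $U_i\leftarrow U_i\times_RV_j\to V_j$. 3. For $U=\{U_i\to R\}_i$ and an $\mathcal E$-morphism $V\to\mathcal O(U)$, $\beta(U)(\{V\to\mathcal O(U)\})$ is the open set $\{U_i\times_{\mathcal O(U)}V\to U_i\to R\}_i$. 4. For $f:A\to B$ in $\mathcal C$, the morphism $\mathrm{Spec}\,f$ pulls back the open set $\{U_i\to B\}_i$ to $\{A\times_BU_i\to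 A\}_i$, and its sheaf component at this open set is induced by the projections $A\times_BU_i\to U_i$. Moreover the canonical morphism $R\to\Gamma(\mathrm{Spec}\,R)$ is an isomorphism, inverse to the counit $\Gamma(\mathrm{Spec}\,R)\to R$ of the adjunction. Consequently $\mathrm{Spec}$ is fully faithful. -/

import Mathlib

open CategoryTheory CategoryTheory.Limits TopologicalSpace

universe w v u

noncomputable section

/-! ### Finite families of distinguished morphisms -/

/-- A finite family `{Uᵢ ⟶ X}ᵢ` of morphisms with target `X` belonging to the class `E`. -/
structure EFamily {C : Type u} [Category.{v} C] (E : MorphismProperty C) (X : C) where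
  n : ℕ
  obj : Fin n → C
  hom : ∀ i, obj i ⟶ X
  mem : ∀ i, E (hom i)

namespace EFamily

section Basic

variable {C : Type u} [Category.{v} C] {E : MorphismProperty C}

/-- `F ⊆ G` as sets of morphisms with target `X`. -/
def Subset {X : C} (F G : EFamily E X) : Prop :=
  ∀ i, ∃ j, Over.mk (F.hom i) = Over.mk (G.hom j)

/-- The empty family. -/
def empty (E : MorphismProperty C) (X : C) : EFamily E X where
  n := 0
  obj i := i.elim0
  hom i := i.elim0
  mem i := i.elim0

/-- The family consisting of a single morphism. -/
def single {X V : C} (f : V ⟶ X) (hf : E f) : EFamily E X where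
  n := 1
  obj _ := V
  hom _ := f
  mem _ := hf

/-- The family `{X ⟶ X}` consisting of the identity. -/
abbrev unit (E : MorphismProperty C) [E.ContainsIdentities] (X : C) : EFamily E X :=
  single (𝟙 X) (E.id_mem X)

/-- The disjoint union of two families. -/
def union {X : C} (F G : EFamily E X) : EFamily E X where
  n := F.n + G.n
  obj k := Sum.elim F.obj G.obj (finSumFinEquiv.symm k)
  hom k := match finSumFinEquiv.symm k with
    | .inl i => F.hom i
    | .inr j => G.hom j
  mem k := match finSumFinEquiv.symm k with
    | .inl i => F.mem i
    | .inr j => G.mem j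

theorem union_forall {X : C} {F G : EFamily E X} {p : ∀ V : C, (V ⟶ X) → Prop}
    (hF : ∀ i, p (F.obj i) (F.hom i)) (hG : ∀ j, p (G.obj j) (G.hom j)) (k : Fin (F.union G).n) :
    p ((F.union G).obj k) ((F.union G).hom k) := by
  dsimp only [union]
  cases finSumFinEquiv.symm k with
  | inl i => exact hF i
  | inr j => exact hG j

theorem union_exists_left {X : C} {F G : EFamily E X} {p : ∀ V : C, (V ⟶ X) → Prop}
    (i : Fin F.n) (hF : p (F.obj i) (F.hom i)) :
    ∃ k, p ((F.union G).obj k) ((F.union G).hom k) := by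
  refine ⟨finSumFinEquiv (Sum.inl i), ?_⟩
  dsimp only [union]
  generalize hx : finSumFinEquiv.symm (finSumFinEquiv (Sum.inl i)) = x
  obtain rfl : Sum.inl i = x := by simpa using hx
  exact hF

theorem union_exists_right {X : C} {F G : EFamily E X} {p : ∀ V : C, (V ⟶ X) → Prop}
    (j : Fin G.n) (hG : p (G.obj j) (G.hom j)) :
    ∃ k, p ((F.union G).obj k) ((F.union G).hom k) := by
  refine ⟨finSumFinEquiv (Sum.inr j), ?_⟩
  dsimp only [union]
  generalize hx : finSumFinEquiv.symm (finSumFinEquiv (Sum.inr j)) = x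
  obtain rfl : Sum.inr j = x := by simpa using hx
  exact hG

/-- A family `{Pᵢ ⟶ X}ᵢ` obtained from `{Uᵢ ⟶ Y}ᵢ` by base change along `f : X ⟶ Y`, for an
arbitrary choice of the fibre products `Pᵢ = X ×_Y Uᵢ`. -/
abbrev ofIsPullback [E.IsStableUnderBaseChange] {X Y : C} (f : X ⟶ Y) (F : EFamily E Y)
    (P : Fin F.n → C) (p : ∀ i, P i ⟶ X) (q : ∀ i, P i ⟶ F.obj i)
    (h : ∀ i, IsPullback (p i) (q i) f (F.hom i)) : EFamily E X where
  n := F.n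
  obj := P
  hom := p
  mem i := E.of_isPullback (h i).flip (F.mem i)

variable [HasPullbacks C]

/-- The base change `{X ×_Y Uᵢ ⟶ X}ᵢ` of `{Uᵢ ⟶ Y}ᵢ` along `f : X ⟶ Y`. -/
abbrev pullback [E.IsStableUnderBaseChange] {X Y : C} (f : X ⟶ Y) (F : EFamily E Y) :
    EFamily E X :=
  ofIsPullback f F (fun i => Limits.pullback f (F.hom i)) (fun i => pullback.fst f (F.hom i))
    (fun i => pullback.snd f (F.hom i)) (fun i => IsPullback.of_hasPullback f (F.hom i))

/-- The family `{Uᵢ ×_X Vⱼ ⟶ X}ᵢⱼ`. -/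
def inter [E.IsStableUnderBaseChange] [E.IsMultiplicative] {X : C} (F G : EFamily E X) :
    EFamily E X where
  n := F.n * G.n
  obj k := Limits.pullback (F.hom (finProdFinEquiv.symm k).1) (G.hom (finProdFinEquiv.symm k).2)
  hom k := pullback.fst (F.hom (finProdFinEquiv.symm k).1) (G.hom (finProdFinEquiv.symm k).2) ≫
    F.hom (finProdFinEquiv.symm k).1
  mem k := E.comp_mem _ _
    (E.of_isPullback (IsPullback.of_hasPullback _ _).flip (G.mem _)) (F.mem _)

theorem inter_forall [E.IsStableUnderBaseChange] [E.IsMultiplicative] {X : C}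
    {F G : EFamily E X} {p : ∀ V : C, (V ⟶ X) → Prop}
    (h : ∀ i j, p (Limits.pullback (F.hom i) (G.hom j))
      (pullback.fst (F.hom i) (G.hom j) ≫ F.hom i)) (k : Fin (F.inter G).n) :
    p ((F.inter G).obj k) ((F.inter G).hom k) :=
  h _ _

theorem inter_exists [E.IsStableUnderBaseChange] [E.IsMultiplicative] {X : C}
    {F G : EFamily E X} {p : ∀ V : C, (V ⟶ X) → Prop} (i : Fin F.n) (j : Fin G.n)
    (h : p (Limits.pullback (F.hom i) (G.hom j)) (pullback.fst (F.hom i) (G.hom j) ≫ F.hom i)) :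
    ∃ k, p ((F.inter G).obj k) ((F.inter G).hom k) := by
  refine ⟨finProdFinEquiv (i, j), ?_⟩
  have key : ∀ x : Fin F.n × Fin G.n, (i, j) = x → p (Limits.pullback (F.hom x.1) (G.hom x.2))
      (pullback.fst (F.hom x.1) (G.hom x.2) ≫ F.hom x.1) := by
    rintro _ rfl
    exact h
  exact key _ (finProdFinEquiv.symm_apply_apply (i, j)).symm

/-- Given morphisms `gᵢ : Uᵢ ⟶ A` from the members of a family `{Uᵢ ⟶ X}ᵢ` and `f : V ⟶ A` in `E`,
the family of composites `{Uᵢ ×_A V ⟶ Uᵢ ⟶ X}ᵢ`. -/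
def along [E.IsStableUnderBaseChange] [E.IsMultiplicative] {X A V : C} (F : EFamily E X)
    (g : ∀ i, F.obj i ⟶ A) (f : V ⟶ A) (hf : E f) : EFamily E X where
  n := F.n
  obj i := Limits.pullback (g i) f
  hom i := pullback.fst (g i) f ≫ F.hom i
  mem i := E.comp_mem _ _
    (E.of_isPullback (IsPullback.of_hasPullback _ _).flip hf) (F.mem i)

variable [HasFiniteCoproducts C]

/-- The projection `p₁ : ∐ᵢⱼ Uᵢ ×_X Uⱼ ⟶ ∐ᵢ Uᵢ`, given by `Uᵢ ×_X Uⱼ ⟶ Uᵢ`. -/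
def p₁ {X : C} (F : EFamily E X) :
    (∐ fun ij : Fin F.n × Fin F.n => Limits.pullback (F.hom ij.1) (F.hom ij.2)) ⟶ ∐ F.obj :=
  Sigma.desc fun ij => pullback.fst (F.hom ij.1) (F.hom ij.2) ≫ Sigma.ι F.obj ij.1

/-- The projection `p₂ : ∐ᵢⱼ Uᵢ ×_X Uⱼ ⟶ ∐ᵢ Uᵢ`, given by `Uᵢ ×_X Uⱼ ⟶ Uⱼ`. -/
def p₂ {X : C} (F : EFamily E X) :
    (∐ fun ij : Fin F.n × Fin F.n => Limits.pullback (F.hom ij.1) (F.hom ij.2)) ⟶ ∐ F.obj :=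
  Sigma.desc fun ij => pullback.snd (F.hom ij.1) (F.hom ij.2) ≫ Sigma.ι F.obj ij.2

/-- The canonical morphism `∐ᵢ Uᵢ ⟶ X`. -/
def toBase {X : C} (F : EFamily E X) : (∐ F.obj) ⟶ X :=
  Sigma.desc F.hom

theorem p₁_toBase {X : C} (F : EFamily E X) : F.p₁ ≫ F.toBase = F.p₂ ≫ F.toBase := by
  refine Sigma.hom_ext _ _ fun ij => ?_
  simp [p₁, p₂, toBase, pullback.condition]

end Basic

end EFamily

/-! ### Coherent sites -/

/-- A coherent site structure `(E, 𝒪)` on a category `C` with fibre products and finite coproducts: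
a wide subcategory `E` and, for every `X`, a collection `cov X` of finite families of `E`-morphisms
with target `X`. -/
structure CoherentSite (C : Type u) [Category.{v} C] [HasPullbacks C] [HasFiniteCoproducts C] where
  E : MorphismProperty C
  [isMultiplicative : E.IsMultiplicative]
  [respectsIso : E.RespectsIso]
  [isStableUnderBaseChange : E.IsStableUnderBaseChange]
  /-- The initial object of `C` is initial in `E`. -/
  initial_mem : ∀ X : C, E (initial.to X)
  mono : ∀ {A R : C} (f : A ⟶ R), E f → Mono f
  /-- `A ×_R (-)` preserves finite coproducts. -/
  flat : ∀ {A R : C} (f : A ⟶ R), E f → PreservesFiniteCoproducts (Over.pullback f)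
  /-- `∐ Uᵢ ×_X Uⱼ ⇉ ∐ Uᵢ` has a coequalizer, with structure morphisms `Uᵢ ⟶ Q` in `E`. -/
  coequalizer : ∀ {X : C} (F : EFamily E X), ∃ (Q : C) (π : (∐ F.obj) ⟶ Q)
    (hπ : F.p₁ ≫ π = F.p₂ ≫ π), Nonempty (IsColimit (Cofork.ofπ π hπ)) ∧
      ∀ i, E (Sigma.ι F.obj i ≫ π)
  cov : ∀ X : C, Set (EFamily E X)
  /-- Descent: `∐ Uᵢ ×_X Uⱼ ⇉ ∐ Uᵢ ⟶ X` is exact for every covering family. -/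
  descent : ∀ {X : C} (F : EFamily E X), F ∈ cov X →
    Nonempty (IsColimit (Cofork.ofπ F.toBase F.p₁_toBase))
  cov_unit : ∀ X : C, EFamily.unit E X ∈ cov X
  cov_mono : ∀ {X : C} (F G : EFamily E X), F.Subset G → F ∈ cov X → G ∈ cov X
  /-- Stability under base change, for any choice of the fibre products. -/
  cov_pullback : ∀ {X Y : C} (f : X ⟶ Y) (F : EFamily E Y), F ∈ cov Y →
    ∀ (P : Fin F.n → C) (p : ∀ i, P i ⟶ X) (q : ∀ i, P i ⟶ F.obj i)
      (h : ∀ i, IsPullback (p i) (q i) f (F.hom i)), EFamily.ofIsPullback f F P p q h ∈ cov X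
  cov_local : ∀ {X : C} (F G : EFamily E X), F ∈ cov X →
    (∀ i, G.pullback (F.hom i) ∈ cov (F.obj i)) → G ∈ cov X

namespace CoherentSite

attribute [instance] isMultiplicative respectsIso isStableUnderBaseChange

section Omega

variable {C : Type u} [Category.{v} C] [HasPullbacks C] [HasFiniteCoproducts C]
  (S : CoherentSite.{v, u} C)

/-- A family having a member with a section is covering. -/
theorem cov_of_section {X : C} (G : EFamily S.E X) (j : Fin G.n) (s : X ⟶ G.obj j)
    (hs : s ≫ G.hom j = 𝟙 X) : G ∈ S.cov X := by
  have := S.mono _ (G.mem j)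
  have : IsIso (G.hom j) := ⟨⟨s, by rw [← cancel_mono (G.hom j)]; simp [hs], hs⟩⟩
  have hp : IsPullback (G.hom j) (G.hom j) (𝟙 X) (𝟙 X) := IsPullback.of_vert_isIso ⟨rfl⟩
  have h := S.cov_pullback (𝟙 X) (EFamily.unit S.E X) (S.cov_unit X) (fun _ => G.obj j)
    (fun _ => G.hom j) (fun _ => G.hom j) (fun _ => hp)
  exact S.cov_mono _ _ (fun _ => ⟨j, rfl⟩) h

theorem cov_of_factor {V R : C} (h : V ⟶ R) (G : EFamily S.E R) (j : Fin G.n)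
    (s : V ⟶ G.obj j) (hs : s ≫ G.hom j = h) : G.pullback h ∈ S.cov V :=
  S.cov_of_section (G.pullback h) j (pullback.lift (𝟙 V) s (by simp [hs]))
    (pullback.lift_fst _ _ _)

theorem cov_pullback_comp {V W R : C} (a : V ⟶ W) (b : W ⟶ R) (G : EFamily S.E R)
    (hG : G.pullback b ∈ S.cov W) : G.pullback (a ≫ b) ∈ S.cov V :=
  S.cov_pullback a (G.pullback b) hG (fun i => Limits.pullback (a ≫ b) (G.hom i))
    (fun _ => pullback.fst _ _) _
    (fun i => (IsPullback.of_right' (IsPullback.of_hasPullback (a ≫ b) (G.hom i)).flip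
      (IsPullback.of_hasPullback b (G.hom i)).flip).flip)

theorem cov_pullback_pullback {V W R : C} (a : V ⟶ W) (b : W ⟶ R) (G : EFamily S.E R)
    (hG : G.pullback (a ≫ b) ∈ S.cov V) : (G.pullback b).pullback a ∈ S.cov V :=
  S.cov_pullback (𝟙 V) (G.pullback (a ≫ b)) hG _
    (fun i => pullback.fst a (pullback.fst b (G.hom i)))
    (fun i => (pullbackRightPullbackFstIso b (G.hom i) a).hom)
    (fun _ => IsPullback.of_vert_isIso (CommSq.mk (by simp)))

/-- The local character of coverings, for base changes of a family. -/
theorem cov_pullback_local {V R : C} (h : V ⟶ R) (G : EFamily S.E R) (F : EFamily S.E V)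
    (hF : F ∈ S.cov V) (hG : ∀ i, G.pullback (F.hom i ≫ h) ∈ S.cov (F.obj i)) :
    G.pullback h ∈ S.cov V :=
  S.cov_local F _ hF fun i => S.cov_pullback_pullback _ _ _ (hG i)

/-! ### The distributive lattice `Ω₁(R)` -/

/-- The collection `Ω₀(R)` of finite families of `E`-morphisms with target `R`. -/
def Omega0 (R : C) : Type (max u v) :=
  EFamily S.E R

/-- `{Uᵢ} ≺ {Vⱼ}` if and only if `{Uᵢ ×_R Vⱼ ⟶ Uᵢ}ⱼ` is a covering of `Uᵢ` for every `i`. -/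
instance (R : C) : LE (S.Omega0 R) where
  le F G := ∀ i : Fin (EFamily.n F), EFamily.pullback (EFamily.hom F i) G ∈ S.cov _

theorem le_of_factor {R : C} {F G : EFamily S.E R}
    (h : ∀ i, ∃ (j : Fin G.n) (s : F.obj i ⟶ G.obj j), s ≫ G.hom j = F.hom i) :
    LE.le (α := S.Omega0 R) F G := by
  intro i
  obtain ⟨j, s, hs⟩ := h i
  exact S.cov_of_factor _ G j s hs

instance (R : C) : Preorder (S.Omega0 R) where
  le_refl F := S.le_of_factor fun i => ⟨i, 𝟙 _, by simp⟩
  le_trans F G H hFG hGH i := by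
    refine S.cov_pullback_local _ H _ (hFG i) fun j => ?_
    have := S.cov_pullback_comp (pullback.snd (EFamily.hom F i) (EFamily.hom G j)) _ H (hGH j)
    rwa [← pullback.condition] at this

/-- `Ω₁(R)`, the quotient of `Ω₀(R)` by the equivalence relation `a ≺ b ∧ b ≺ a`. -/
def Omega1 (R : C) : Type (max u v) :=
  Antisymmetrization (S.Omega0 R) (· ≤ ·)

instance (R : C) : PartialOrder (S.Omega1 R) :=
  inferInstanceAs (PartialOrder (Antisymmetrization (S.Omega0 R) (· ≤ ·)))

/-- The class in `Ω₁(R)` of a finite family of `E`-morphisms. -/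
def cls {R : C} (F : EFamily S.E R) : S.Omega1 R :=
  toAntisymmetrization (α := S.Omega0 R) (· ≤ ·) F

theorem cls_le_cls {R : C} {F G : EFamily S.E R} :
    S.cls F ≤ S.cls G ↔ ∀ i, G.pullback (F.hom i) ∈ S.cov (F.obj i) :=
  Iff.rfl

theorem cls_le_cls_of_factor {R : C} {F G : EFamily S.E R}
    (h : ∀ i, ∃ (j : Fin G.n) (s : F.obj i ⟶ G.obj j), s ≫ G.hom j = F.hom i) :
    S.cls F ≤ S.cls G :=
  S.le_of_factor h

theorem ind {R : C} {p : S.Omega1 R → Prop} (h : ∀ F, p (S.cls F)) (a : S.Omega1 R) : p a :=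
  Quotient.ind h a

theorem cls_union_le {R : C} {F G H : EFamily S.E R} (hF : S.cls F ≤ S.cls H)
    (hG : S.cls G ≤ S.cls H) : S.cls (F.union G) ≤ S.cls H :=
  EFamily.union_forall (p := fun V f => H.pullback f ∈ S.cov V) hF hG

theorem cls_le_union_left {R : C} (F G : EFamily S.E R) : S.cls F ≤ S.cls (F.union G) :=
  S.cls_le_cls_of_factor fun i =>
    EFamily.union_exists_left (p := fun V f => ∃ s : F.obj i ⟶ V, s ≫ f = F.hom i) i
      ⟨𝟙 _, Category.id_comp _⟩

theorem cls_le_union_right {R : C} (F G : EFamily S.E R) : S.cls G ≤ S.cls (F.union G) :=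
  S.cls_le_cls_of_factor fun i =>
    EFamily.union_exists_right (p := fun V f => ∃ s : G.obj i ⟶ V, s ≫ f = G.hom i) i
      ⟨𝟙 _, Category.id_comp _⟩

theorem cls_inter_le_left {R : C} (F G : EFamily S.E R) : S.cls (F.inter G) ≤ S.cls F :=
  S.cls_le_cls_of_factor <| EFamily.inter_forall
    (p := fun V f => ∃ (j : Fin F.n) (s : V ⟶ F.obj j), s ≫ F.hom j = f)
    fun i _ => ⟨i, pullback.fst _ _, rfl⟩

theorem cls_inter_le_right {R : C} (F G : EFamily S.E R) : S.cls (F.inter G) ≤ S.cls G :=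
  S.cls_le_cls_of_factor <| EFamily.inter_forall
    (p := fun V f => ∃ (j : Fin G.n) (s : V ⟶ G.obj j), s ≫ G.hom j = f)
    fun _ j => ⟨j, pullback.snd _ _, pullback.condition.symm⟩

theorem factor_inter {R V : C} {F G : EFamily S.E R} (h : V ⟶ R) (i : Fin F.n) (j : Fin G.n)
    (s : V ⟶ F.obj i) (hs : s ≫ F.hom i = h) (t : V ⟶ G.obj j) (ht : t ≫ G.hom j = h) :
    ∃ (k : Fin (F.inter G).n) (r : V ⟶ (F.inter G).obj k), r ≫ (F.inter G).hom k = h :=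
  EFamily.inter_exists (p := fun W f => ∃ r : V ⟶ W, r ≫ f = h) i j
    ⟨pullback.lift s t (hs.trans ht.symm), by rw [pullback.lift_fst_assoc, hs]⟩

theorem le_cls_inter {R : C} {F G H : EFamily S.E R} (hF : S.cls H ≤ S.cls F)
    (hG : S.cls H ≤ S.cls G) : S.cls H ≤ S.cls (F.inter G) := by
  rw [cls_le_cls] at *
  intro k
  refine S.cov_pullback_local _ _ _ (hF k) fun i => ?_
  refine S.cov_pullback_local _ _ _
    (S.cov_pullback_comp (pullback.fst (H.hom k) (F.hom i)) _ G (hG k)) fun j => ?_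
  obtain ⟨l, r, hr⟩ := S.factor_inter (F := F) (G := G)
    (pullback.fst (pullback.fst (H.hom k) (F.hom i) ≫ H.hom k) (G.hom j) ≫
      pullback.fst (H.hom k) (F.hom i) ≫ H.hom k) i j
    (pullback.fst _ _ ≫ pullback.snd _ _) (by simp [pullback.condition])
    (pullback.snd _ _) pullback.condition.symm
  exact S.cov_of_factor _ _ l r hr

instance (R : C) : Lattice (S.Omega1 R) where
  sup := Quotient.map₂ EFamily.union fun _ F' hF _ G' hG =>
    ⟨S.cls_union_le (le_trans (b := S.cls F') hF.1 (S.cls_le_union_left _ _))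
      (le_trans (b := S.cls G') hG.1 (S.cls_le_union_right _ _)),
     S.cls_union_le (le_trans (b := S.cls _) hF.2 (S.cls_le_union_left _ _))
      (le_trans (b := S.cls _) hG.2 (S.cls_le_union_right _ _))⟩
  inf := Quotient.map₂ EFamily.inter fun F F' hF G G' hG =>
    ⟨S.le_cls_inter (le_trans (b := S.cls F) (S.cls_inter_le_left _ _) hF.1)
      (le_trans (b := S.cls G) (S.cls_inter_le_right _ _) hG.1),
     S.le_cls_inter (le_trans (b := S.cls F') (S.cls_inter_le_left _ _) hF.2)
      (le_trans (b := S.cls G') (S.cls_inter_le_right _ _) hG.2)⟩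
  le_sup_left := S.ind fun F => S.ind fun G => S.cls_le_union_left F G
  le_sup_right := S.ind fun F => S.ind fun G => S.cls_le_union_right F G
  sup_le := S.ind fun F => S.ind fun G => S.ind fun H => S.cls_union_le (F := F) (G := G) (H := H)
  inf_le_left := S.ind fun F => S.ind fun G => S.cls_inter_le_left F G
  inf_le_right := S.ind fun F => S.ind fun G => S.cls_inter_le_right F G
  le_inf := S.ind fun H => S.ind fun F => S.ind fun G => S.le_cls_inter (F := F) (G := G) (H := H)

theorem cls_sup_cls {R : C} (F G : EFamily S.E R) : S.cls F ⊔ S.cls G = S.cls (F.union G) := rfl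

theorem cls_inf_cls {R : C} (F G : EFamily S.E R) : S.cls F ⊓ S.cls G = S.cls (F.inter G) := rfl

instance (R : C) : DistribLattice (S.Omega1 R) :=
  DistribLattice.ofInfSupLe <| S.ind fun F => S.ind fun G => S.ind fun H => by
    simp only [cls_sup_cls, cls_inf_cls]
    refine S.cls_le_cls_of_factor <| EFamily.inter_forall
      (p := fun V f => ∃ (j : Fin ((F.inter G).union (F.inter H)).n)
        (s : V ⟶ ((F.inter G).union (F.inter H)).obj j),
        s ≫ ((F.inter G).union (F.inter H)).hom j = f) fun i k => ?_
    revert k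
    refine EFamily.union_forall (F := G) (G := H)
      (p := fun W g => ∃ (j : Fin ((F.inter G).union (F.inter H)).n)
        (s : Limits.pullback (F.hom i) g ⟶ ((F.inter G).union (F.inter H)).obj j),
        s ≫ ((F.inter G).union (F.inter H)).hom j = pullback.fst (F.hom i) g ≫ F.hom i) ?_ ?_
    · intro j
      obtain ⟨l, r, hr⟩ := S.factor_inter (F := F) (G := G) _ i j (pullback.fst _ _) rfl
        (pullback.snd _ _) pullback.condition.symm
      exact EFamily.union_exists_left
        (p := fun V f => ∃ s : Limits.pullback (F.hom i) (G.hom j) ⟶ V, s ≫ f = _) l ⟨r, hr⟩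
    · intro j
      obtain ⟨l, r, hr⟩ := S.factor_inter (F := F) (G := H) _ i j (pullback.fst _ _) rfl
        (pullback.snd _ _) pullback.condition.symm
      exact EFamily.union_exists_right
        (p := fun V f => ∃ s : Limits.pullback (F.hom i) (H.hom j) ⟶ V, s ≫ f = _) l ⟨r, hr⟩

instance (R : C) : BoundedOrder (S.Omega1 R) where
  top := S.cls (EFamily.unit S.E R)
  le_top := S.ind fun F => S.cls_le_cls_of_factor fun i =>
    ⟨(0 : Fin 1), F.hom i, Category.comp_id _⟩
  bot := S.cls (EFamily.empty S.E R)
  bot_le := S.ind fun _ => S.cls_le_cls_of_factor fun i => Fin.elim0 i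

theorem top_eq (R : C) : (⊤ : S.Omega1 R) = S.cls (EFamily.unit S.E R) := rfl

theorem bot_eq (R : C) : (⊥ : S.Omega1 R) = S.cls (EFamily.empty S.E R) := rfl

theorem factor_pullback {A R V : C} (f : A ⟶ R) {F : EFamily S.E R} (a : V ⟶ A) (i : Fin F.n)
    (s : V ⟶ F.obj i) (hs : s ≫ F.hom i = a ≫ f) :
    ∃ (k : Fin (F.pullback f).n) (r : V ⟶ (F.pullback f).obj k), r ≫ (F.pullback f).hom k = a :=
  ⟨i, pullback.lift a s hs.symm, pullback.lift_fst _ _ _⟩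

theorem cls_pullback_mono {A R : C} (f : A ⟶ R) {F G : EFamily S.E R} (h : S.cls F ≤ S.cls G) :
    S.cls (F.pullback f) ≤ S.cls (G.pullback f) := by
  rw [cls_le_cls] at *
  intro i
  refine S.cov_pullback_pullback _ _ _ ?_
  have := S.cov_pullback_comp (pullback.snd f (F.hom i)) _ G (h i)
  rwa [← pullback.condition] at this

/-- The homomorphism `Ω₁(R) ⟶ Ω₁(A)`, `{Uᵢ} ↦ {A ×_R Uᵢ}`, induced by `f : A ⟶ R`. -/
def omegaMap {A R : C} (f : A ⟶ R) : BoundedLatticeHom (S.Omega1 R) (S.Omega1 A) where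
  toFun := Quotient.map (EFamily.pullback f) fun _ _ h =>
    ⟨S.cls_pullback_mono f h.1, S.cls_pullback_mono f h.2⟩
  map_sup' := S.ind fun F => S.ind fun G => by
    change S.cls ((F.union G).pullback f) = S.cls ((F.pullback f).union (G.pullback f))
    refine le_antisymm (S.cls_le_cls_of_factor ?_) (S.cls_union_le ?_ ?_)
    · refine EFamily.union_forall (F := F) (G := G)
        (p := fun W g => ∃ (j : Fin ((F.pullback f).union (G.pullback f)).n)
          (s : Limits.pullback f g ⟶ ((F.pullback f).union (G.pullback f)).obj j),
          s ≫ ((F.pullback f).union (G.pullback f)).hom j = pullback.fst f g) ?_ ?_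
      · intro i
        exact EFamily.union_exists_left (F := F.pullback f)
          (p := fun V h => ∃ s : Limits.pullback f (F.hom i) ⟶ V, s ≫ h = _) i
          ⟨𝟙 _, Category.id_comp _⟩
      · intro i
        exact EFamily.union_exists_right (G := G.pullback f)
          (p := fun V h => ∃ s : Limits.pullback f (G.hom i) ⟶ V, s ≫ h = _) i
          ⟨𝟙 _, Category.id_comp _⟩
    · exact S.cls_pullback_mono f (S.cls_le_union_left F G)
    · exact S.cls_pullback_mono f (S.cls_le_union_right F G)
  map_inf' := S.ind fun F => S.ind fun G => by
    change S.cls ((F.inter G).pullback f) = S.cls ((F.pullback f).inter (G.pullback f))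
    refine le_antisymm (S.le_cls_inter ?_ ?_) (S.cls_le_cls_of_factor ?_)
    · exact S.cls_pullback_mono f (S.cls_inter_le_left F G)
    · exact S.cls_pullback_mono f (S.cls_inter_le_right F G)
    · refine EFamily.inter_forall (F := F.pullback f) (G := G.pullback f)
        (p := fun V h => ∃ (k : Fin ((F.inter G).pullback f).n)
          (r : V ⟶ ((F.inter G).pullback f).obj k), r ≫ ((F.inter G).pullback f).hom k = h) ?_
      intro i j
      obtain ⟨k, r, hr⟩ := S.factor_inter (F := F) (G := G)
        ((pullback.fst (pullback.fst f (F.hom i)) (pullback.fst f (G.hom j)) ≫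
          pullback.fst f (F.hom i)) ≫ f) i j
        (pullback.fst _ _ ≫ pullback.snd _ _) (by
          rw [Category.assoc, Category.assoc, pullback.condition (f := f) (g := F.hom i)])
        (pullback.snd _ _ ≫ pullback.snd _ _) (by
          rw [pullback.condition (f := pullback.fst f (F.hom i)), Category.assoc, Category.assoc,
            pullback.condition (f := f) (g := G.hom j)])
      exact S.factor_pullback f _ k r hr
  map_top' := by
    refine top_unique (S.cls_le_cls_of_factor fun _ => ?_)
    exact S.factor_pullback f (𝟙 A) (F := EFamily.unit S.E R) (0 : Fin 1) f
      ((Category.comp_id f).trans (Category.id_comp f).symm)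
  map_bot' := bot_unique (S.cls_le_cls_of_factor fun i => Fin.elim0 i)

theorem omegaMap_cls {A R : C} (f : A ⟶ R) (F : EFamily S.E R) :
    S.omegaMap f (S.cls F) = S.cls (F.pullback f) := rfl

theorem omegaMap_id (R : C) (a : S.Omega1 R) : S.omegaMap (𝟙 R) a = a := by
  induction a using S.ind with
  | h F =>
  refine le_antisymm (S.cls_le_cls_of_factor fun i => ?_) (S.cls_le_cls_of_factor fun i => ?_)
  · exact ⟨i, pullback.snd _ _, by simpa using (pullback.condition (f := 𝟙 R)).symm⟩
  · exact S.factor_pullback _ _ i (𝟙 _) (by simp)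

theorem omegaMap_comp {A B R : C} (f : A ⟶ B) (g : B ⟶ R) (a : S.Omega1 R) :
    S.omegaMap (f ≫ g) a = S.omegaMap f (S.omegaMap g a) := by
  induction a using S.ind with
  | h F =>
  refine le_antisymm (S.cls_le_cls_of_factor fun i => ?_) (S.cls_le_cls_of_factor fun i => ?_)
  · exact S.factor_pullback f (F := F.pullback g) _ i
      (pullback.lift (pullback.fst _ _ ≫ f) (pullback.snd _ _) (by simp [pullback.condition]))
      (pullback.lift_fst _ _ _)
  · refine S.factor_pullback (f ≫ g) (F := F) _ i (pullback.snd _ _ ≫ pullback.snd _ _) ?_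
    rw [Category.assoc, ← pullback.condition, ← Category.assoc, ← pullback.condition,
      Category.assoc]

end Omega

end CoherentSite
/-! ### Coherent spaces

A coherent space is a topological space which is sober (`T0Space` and `QuasiSober`), quasi-compact,
quasi-separated and has a basis of quasi-compact open subsets; this is `SpectralSpace`. The
quasi-compact continuous maps are the `SpectralMap`s, and `Ω_c(X)` is `CompactOpens X`. -/

instance CompactOpens.instDistribLattice (X : Type w) [TopologicalSpace X]
    [QuasiSeparatedSpace X] : DistribLattice (CompactOpens X) where
  __ := (inferInstance : SemilatticeSup (CompactOpens X))
  __ := (inferInstance : SemilatticeInf (CompactOpens X))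
  le_sup_inf U V W := fun x (hx : (x ∈ U ∨ x ∈ V) ∧ (x ∈ U ∨ x ∈ W)) => by
    change x ∈ U ∨ (x ∈ V ∧ x ∈ W)
    tauto

/-- The inverse image of quasi-compact open subsets. -/
def SpectralMap.comap {X Y : Type w} [TopologicalSpace X] [TopologicalSpace Y]
    (f : SpectralMap X Y) (U : CompactOpens Y) : CompactOpens X where
  carrier := f ⁻¹' U
  isCompact' := U.isCompact.preimage_of_isOpen f.spectral' U.isOpen
  isOpen' := U.isOpen.preimage f.spectral'.continuous

theorem SpectralMap.comap_mono {X Y : Type w} [TopologicalSpace X] [TopologicalSpace Y]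
    (f : SpectralMap X Y) {U V : CompactOpens Y} (h : U ≤ V) : f.comap U ≤ f.comap V :=
  fun _ hx => h hx

section Sheaf

variable {C : Type u} [Category.{v} C] [HasFiniteCoproducts C]
  {X : Type w} [TopologicalSpace X] [SpectralSpace X]

/-- `O : Ω_c(X) ⥤ C` is a `Cᵒᵖ`-valued sheaf on the coherent space `X`: for every finite family
`Wᵢ` of quasi-compact open subsets,
`∐ᵢⱼ O(Wᵢ ∩ Wⱼ) ⇉ ∐ᵢ O(Wᵢ) ⟶ O(⋃ᵢ Wᵢ)` is a coequalizer diagram in `C`. -/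
def IsOpSheaf (O : CompactOpens X ⥤ C) : Prop :=
  ∀ (n : ℕ) (W : Fin n → CompactOpens X),
    ∃ h : (Sigma.desc fun ij : Fin n × Fin n =>
          O.map (homOfLE (inf_le_left : W ij.1 ⊓ W ij.2 ≤ W ij.1)) ≫
            Sigma.ι (fun i => O.obj (W i)) ij.1) ≫
        (Sigma.desc fun i => O.map (homOfLE (Finset.le_sup (f := W) (Finset.mem_univ i)))) =
      (Sigma.desc fun ij : Fin n × Fin n =>
          O.map (homOfLE (inf_le_right : W ij.1 ⊓ W ij.2 ≤ W ij.2)) ≫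
            Sigma.ι (fun i => O.obj (W i)) ij.2) ≫
        (Sigma.desc fun i => O.map (homOfLE (Finset.le_sup (f := W) (Finset.mem_univ i)))),
      Nonempty (IsColimit (Cofork.ofπ (P := O.obj (Finset.univ.sup W)) _ h))

end Sheaf

/-- `U ↦ Ω_c(U)` is a sheaf: compatible families of quasi-compact open subsets `Vᵢ ⊆ Wᵢ` glue
uniquely to a quasi-compact open subset of `⋃ᵢ Wᵢ`. -/
theorem CompactOpens.existsUnique_glue {X : Type w} [TopologicalSpace X] [SpectralSpace X] {n : ℕ}
    (W V : Fin n → CompactOpens X) (hVW : ∀ i, V i ≤ W i)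
    (h : ∀ i j, V i ⊓ (W i ⊓ W j) = V j ⊓ (W i ⊓ W j)) :
    ∃! T : CompactOpens X, T ≤ Finset.univ.sup W ∧ ∀ i, T ⊓ W i = V i := by
  refine ⟨Finset.univ.sup V, ⟨Finset.sup_mono_fun fun i _ => hVW i, fun i => ?_⟩, ?_⟩
  · rw [Finset.sup_inf_distrib_right]
    refine le_antisymm (Finset.sup_le fun j _ => ?_) ?_
    · calc V j ⊓ W i = V j ⊓ (W i ⊓ W j) := by
            rw [inf_comm (W i), ← inf_assoc, inf_eq_left.2 (hVW j)]
        _ = V i ⊓ (W i ⊓ W j) := (h i j).symm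
        _ ≤ V i := inf_le_left
    · exact (le_inf le_rfl (hVW i)).trans
        (Finset.le_sup (f := fun j => V j ⊓ W i) (Finset.mem_univ i))
  · rintro T ⟨hT, hTV⟩
    calc T = T ⊓ Finset.univ.sup W := (inf_eq_left.2 hT).symm
      _ = Finset.univ.sup fun i => T ⊓ W i := Finset.sup_inf_distrib_left _ _ _
      _ = Finset.univ.sup V := by simp only [hTV]

/-! ### Weak `C`-schemes -/

section WeakScheme

variable {C : Type u} [Category.{v} C] [HasPullbacks C] [HasFiniteCoproducts C]

/-- A weak `C`-scheme `(X, 𝒪, β)`.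

The distributive lattice `τ(U) = Ω_c(U)` is the lattice `Set.Iic U` of quasi-compact open subsets
of `X` contained in `U`. The support morphism `β : σ ⟶ τ` has as source the sheaf `σ` associated
with the presheaf `U ↦ Ω₁(𝒪(U))` of distributive lattices; since `τ` is a sheaf
(`CompactOpens.existsUnique_glue`), it is, by the universal property of the associated sheaf, a
family of lattice homomorphisms `Ω₁(𝒪(U)) ⟶ τ(U)` compatible with restrictions. -/
structure WeakScheme (S : CoherentSite.{v, u} C) where
  carrier : Type w
  [topologicalSpace : TopologicalSpace carrier]
  [spectralSpace : SpectralSpace carrier]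
  sheaf : CompactOpens carrier ⥤ C
  isOpSheaf : IsOpSheaf sheaf
  support : ∀ U : CompactOpens carrier, BoundedLatticeHom (S.Omega1 (sheaf.obj U)) (Set.Iic U)
  support_map : ∀ {V U : CompactOpens carrier} (h : V ≤ U) (a : S.Omega1 (sheaf.obj U)),
    (support V (S.omegaMap (sheaf.map (homOfLE h)) a) : CompactOpens carrier) =
      (support U a : CompactOpens carrier) ⊓ V
  /-- If `V ⊆ β(U)({A ⟶ 𝒪(U)})`, then `𝒪(V) ⟶ 𝒪(U)` factors through `A ⟶ 𝒪(U)`. -/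
  factor : ∀ {V U : CompactOpens carrier} (h : V ≤ U) {A : C} (j : A ⟶ sheaf.obj U) (hj : S.E j),
    V ≤ (support U (S.cls (EFamily.single j hj)) : CompactOpens carrier) →
      ∃ g : sheaf.obj V ⟶ A, g ≫ j = sheaf.map (homOfLE h)

namespace WeakScheme

attribute [instance] topologicalSpace spectralSpace

/-- A morphism `(f, f^#)` of weak `C`-schemes; `f^#(U) : 𝒪_X(f⁻¹ U) ⟶ 𝒪_Y(U)` in `C`. -/
@[ext]
structure Hom {S : CoherentSite.{v, u} C} (X Y : WeakScheme.{w} S) where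
  base : SpectralMap X.carrier Y.carrier
  app : ∀ U : CompactOpens Y.carrier, X.sheaf.obj (base.comap U) ⟶ Y.sheaf.obj U
  naturality : ∀ {V U : CompactOpens Y.carrier} (h : V ≤ U),
    X.sheaf.map (homOfLE (base.comap_mono h)) ≫ app U = app V ≫ Y.sheaf.map (homOfLE h)
  support_app : ∀ (U : CompactOpens Y.carrier) (a : S.Omega1 (Y.sheaf.obj U)),
    (X.support (base.comap U) (S.omegaMap (app U) a) : CompactOpens X.carrier) =
      base.comap (Y.support U a : CompactOpens Y.carrier)

instance (S : CoherentSite.{v, u} C) : Category (WeakScheme.{w} S) where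
  Hom X Y := Hom X Y
  id X :=
    { base := SpectralMap.id X.carrier
      app := fun U => 𝟙 (X.sheaf.obj U)
      naturality := fun h => (Category.comp_id _).trans (Category.id_comp _).symm
      support_app := fun U a =>
        congrArg (fun b => (X.support U b : CompactOpens X.carrier)) (S.omegaMap_id _ a) }
  comp {X Y Z} f g :=
    { base := g.base.comp f.base
      app := fun U => f.app (g.base.comap U) ≫ g.app U
      naturality := fun {V U} h => by
        have h₁ := f.naturality (g.base.comap_mono h)
        have h₂ := g.naturality h
        calc X.sheaf.map (homOfLE (f.base.comap_mono (g.base.comap_mono h))) ≫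
              f.app (g.base.comap U) ≫ g.app U
            = (f.app (g.base.comap V) ≫ Y.sheaf.map (homOfLE (g.base.comap_mono h))) ≫
                g.app U := by rw [← h₁, Category.assoc]
          _ = (f.app (g.base.comap V) ≫ g.app V) ≫ Z.sheaf.map (homOfLE h) := by
              rw [Category.assoc, h₂, Category.assoc]
      support_app := fun U a => by
        have h₁ := f.support_app (g.base.comap U) (S.omegaMap (g.app U) a)
        rw [g.support_app] at h₁
        exact (congrArg (fun b => (X.support (f.base.comap (g.base.comap U)) b :
          CompactOpens X.carrier)) (S.omegaMap_comp _ _ a)).trans h₁ }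
  id_comp f := Hom.ext rfl (heq_of_eq (funext fun _ => Category.id_comp _))
  comp_id f := Hom.ext rfl (heq_of_eq (funext fun _ => Category.comp_id _))
  assoc f g h := Hom.ext rfl (heq_of_eq (funext fun _ => Category.assoc _ _ _))

/-- The global sections functor `Γ`, `X ↦ 𝒪_X(X)`. -/
def Γ (S : CoherentSite.{v, u} C) : WeakScheme.{w} S ⥤ C where
  obj X := X.sheaf.obj ⊤
  map {X Y} f := X.sheaf.map (homOfLE (show ⊤ ≤ f.base.comap ⊤ from fun _ h => h)) ≫ f.app ⊤
  map_id X := (Category.comp_id _).trans (X.sheaf.map_id _)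
  map_comp {X Y Z} f g := by
    have hf : (⊤ : CompactOpens X.carrier) ≤ f.base.comap ⊤ := fun _ h => h
    have hg : (⊤ : CompactOpens Y.carrier) ≤ g.base.comap ⊤ := fun _ h => h
    have key : X.sheaf.map (homOfLE (hf.trans (f.base.comap_mono hg))) ≫
        f.app (g.base.comap ⊤) ≫ g.app ⊤ =
        (X.sheaf.map (homOfLE hf) ≫ f.app ⊤) ≫ Y.sheaf.map (homOfLE hg) ≫ g.app ⊤ := by
      have h := f.naturality hg
      calc _ = (X.sheaf.map (homOfLE hf) ≫ X.sheaf.map (homOfLE (f.base.comap_mono hg))) ≫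
              f.app (g.base.comap ⊤) ≫ g.app ⊤ := by rw [← Functor.map_comp]; rfl
        _ = X.sheaf.map (homOfLE hf) ≫ (f.app ⊤ ≫ Y.sheaf.map (homOfLE hg)) ≫ g.app ⊤ := by
            rw [← h]
            simp only [Category.assoc]
        _ = _ := by simp only [Category.assoc]
    exact key

end WeakScheme

/-! ### Spectra -/

/-- The space `Spec⁰ R = pt(comp(Ω₁(R)))`: the points of the complete lattice of ideals (non-empty
lower sets closed under finite joins) of the distributive lattice `Ω₁(R)`. -/
abbrev CoherentSite.Spec0 (S : CoherentSite.{v, u} C) (R : C) : Type (max u v) :=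
  Locale.PT (Order.Ideal (S.Omega1 R))

/-- A presentation of a weak `C`-scheme `X` as the spectrum of `R`. -/
structure SpectrumData (S : CoherentSite.{v, u} C) (R : C) (X : WeakScheme.{w} S) where
  /-- `|X| = Spec⁰ R`. -/
  homeo : X.carrier ≃ₜ S.Spec0 R
  /-- The induced identification of `Ω₁(R)` with the lattice of quasi-compact open subsets,
  under which `a` corresponds to the set of points `p` with `p(↓a) = 1`. -/
  basic : S.Omega1 R ≃o CompactOpens X.carrier
  mem_basic : ∀ (a : S.Omega1 R) (x : X.carrier), x ∈ basic a ↔ homeo x (Order.Ideal.principal a)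
  /-- For `U = {Uᵢ ⟶ R}`, a coequalizer `∐ Uᵢ ×_R Uⱼ ⇉ ∐ Uᵢ ⟶ 𝒪(U)`. -/
  π : ∀ F : EFamily S.E R, (∐ F.obj) ⟶ X.sheaf.obj (basic (S.cls F))
  condition : ∀ F : EFamily S.E R, F.p₁ ≫ π F = F.p₂ ≫ π F
  isColimit : ∀ F : EFamily S.E R, IsColimit (Cofork.ofπ (π F) (condition F))
  /-- For `U = {Uᵢ} ≺ {Vⱼ} = V`, the morphism `𝒪(U) ⟶ 𝒪(V)` is the one induced by the projections
  from the `Uᵢ ×_R Vⱼ` to `Uᵢ` and to `Vⱼ`. -/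
  π_map : ∀ (F G : EFamily S.E R) (h : S.cls F ≤ S.cls G) (i : Fin F.n) (j : Fin G.n),
    pullback.fst (F.hom i) (G.hom j) ≫ Sigma.ι F.obj i ≫ π F ≫
        X.sheaf.map (homOfLE (basic.monotone h)) =
      pullback.snd (F.hom i) (G.hom j) ≫ Sigma.ι G.obj j ≫ π G
  /-- The support morphism: for `U = {Uᵢ ⟶ R}` and an `E`-morphism `V ⟶ 𝒪(U)`, the open set
  `β(U)(V)` is `{Uᵢ ×_{𝒪(U)} V ⟶ Uᵢ ⟶ R}`. -/
  support_basic : ∀ (F : EFamily S.E R) {V : C} (f : V ⟶ X.sheaf.obj (basic (S.cls F)))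
    (hf : S.E f),
    (X.support (basic (S.cls F)) (S.cls (EFamily.single f hf)) : CompactOpens X.carrier) =
      basic (S.cls (F.along (fun i => Sigma.ι F.obj i ≫ π F) f hf))

namespace SpectrumData

variable {S : CoherentSite.{v, u} C}

/-- The canonical morphism `R ⟶ Γ(Spec R)`, given by `R ⟶ 𝒪(U)` for `U = {R ⟶ R}`, which is the
whole space. -/
def canonical {R : C} {X : WeakScheme.{w} S} (D : SpectrumData S R X) :
    R ⟶ (WeakScheme.Γ S).obj X :=
  Sigma.ι (EFamily.unit S.E R).obj (0 : Fin 1) ≫ D.π (EFamily.unit S.E R) ≫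
    X.sheaf.map (homOfLE le_top)

/-- The morphism `φ : X ⟶ Y` of spectra is the one induced by `f : A ⟶ B`: it pulls back the open
set `U = {Uᵢ ⟶ B}` to `{A ×_B Uᵢ ⟶ A}`, and `𝒪_X(φ⁻¹ U) ⟶ 𝒪_Y(U)` is induced by the projections
`A ×_B Uᵢ ⟶ Uᵢ`. -/
def IsInducedBy {A B : C} {X Y : WeakScheme.{w} S} (D : SpectrumData S A X)
    (D' : SpectrumData S B Y) (f : A ⟶ B) (φ : X ⟶ Y) : Prop :=
  ∀ F : EFamily S.E B,
    ∃ h : φ.base.comap (D'.basic (S.cls F)) = D.basic (S.cls (F.pullback f)),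
      ∀ i : Fin F.n,
        Sigma.ι (F.pullback f).obj i ≫ D.π (F.pullback f) ≫ X.sheaf.map (homOfLE h.ge) ≫
            φ.app (D'.basic (S.cls F)) =
          pullback.snd f (F.hom i) ≫ Sigma.ι F.obj i ≫ D'.π F

end SpectrumData

end WeakScheme

end

/-! Everything rests on one notion: `h : T ⟶ R` forces `a ∈ Ω₁(R)` when the family representing `a`
becomes a covering of `T` after base change. Forcing is stable under precomposition and local for
coverings, and `a ≤ b` as soon as every morphism forcing `a` forces `b` (`le_of_forces`); so `a` can
be handled as the sieve of morphisms forcing it. Descent along coverings then shows that the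
coequalizer `sections a` does not depend on the representing family, and that morphisms `sections a
⟶ Z` amount to natural families of morphisms `T ⟶ Z` indexed by the `T ⟶ R` forcing `a`
(`sections_hom_ext'`, `exists_sections_desc_of_natural`). Restriction maps and the projection to `R`
come from this property, and the sheaf condition from families adapted to a finite join
(`exists_family_sup`). The support of `b ∈ Ω₁(sections a)` is the only `c ≤ a` whose inverse image
along each `h` forcing `a` is that of `b` along `toSections h` (`supp_eq_of`); all axioms on the
support are checked on forcing morphisms.

The topology is Stone duality: points of the frame of ideals of `L` are lattice homomorphisms `L →
Prop`, the prime ideal theorem identifies `L` with the quasi-compact opens, and homomorphisms from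
`L` to the quasi-compact opens of `X` come from spectral maps.

For the adjunction, `g : Γ(X) ⟶ R` gives `Ω₁(R) → Ω₁(Γ(X)) → Ω_c(X)`, hence a spectral map. Over the
inverse image `Wᵢ` of an `E`-morphism `Uᵢ ⟶ R` the factorization axiom yields `𝒪(Wᵢ) ⟶ Uᵢ`, and
these glue to maps into `sections a` (`exists_isInduced`). Conversely a morphism to the spectrum is
determined by its transpose: compatibility with supports fixes inverse images (`comap_basicOpen`),
and over the open set of one `E`-morphism `V ⟶ R` the sections are `V`, which is monic over `R`, so
the sheaf component is fixed as well (`map_app_eq`). Since the identity of `R` forces `⊤`, the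
counit `Γ(Spec R) ⟶ R` is invertible, and full faithfulness is formal. -/

noncomputable section

/-! ### The space of points of the frame of ideals of a distributive lattice -/

namespace IdealPoints

open Order Topology

variable {L : Type*} [DistribLattice L] [BoundedOrder L]

/-- An ideal is the join of the principal ideals of its elements, and a point preserves arbitrary
joins. Hence a point is determined by its values on principal ideals. -/
theorem apply_iff (p : Locale.PT (Ideal L)) (I : Ideal L) :
    p I ↔ ∃ a ∈ I, p (Ideal.principal a) := by
  have h : I = sSup (Ideal.principal '' (I : Set L)) := by
    refine le_antisymm (fun a ha => ?_) (sSup_le ?_)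
    · exact Ideal.principal_le_iff.1 (le_sSup ⟨a, ha, rfl⟩)
    · rintro _ ⟨a, ha, rfl⟩
      exact Ideal.principal_le_iff.2 ha
  conv_lhs => rw [h, map_sSup, sSup_image, iSup_Prop_eq]
  simp only [iSup_Prop_eq, exists_prop]
  exact Set.exists_mem_image

/-- The lattice homomorphism `a ↦ p(↓a)` associated with a point. -/
def toHom (p : Locale.PT (Ideal L)) : BoundedLatticeHom L Prop where
  toFun a := p (Ideal.principal a)
  map_sup' a b := by
    have h : Ideal.principal (a ⊔ b) = Ideal.principal a ⊔ Ideal.principal b := by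
      refine le_antisymm ?_ (sup_le ?_ ?_)
      · exact Ideal.principal_le_iff.2 (Ideal.sup_mem
          ((le_sup_left : Ideal.principal a ≤ _) Ideal.mem_principal_self)
          ((le_sup_right : Ideal.principal b ≤ _) Ideal.mem_principal_self))
      · exact Ideal.principal_le_iff.2 le_sup_left
      · exact Ideal.principal_le_iff.2 le_sup_right
    rw [h, map_sup]
  map_inf' a b := by
    have h : Ideal.principal (a ⊓ b) = Ideal.principal a ⊓ Ideal.principal b := by
      ext x
      simp
    rw [h, map_inf]
  map_top' := by rw [Ideal.principal_top, map_top]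
  map_bot' := by rw [Ideal.principal_bot, map_bot]

theorem toHom_apply (p : Locale.PT (Ideal L)) (a : L) :
    toHom p a = p (Ideal.principal a) := rfl

theorem toHom_injective : Function.Injective (toHom (L := L)) := by
  intro p q h
  refine FrameHom.ext fun I => ?_
  rw [eq_iff_iff, apply_iff p, apply_iff q]
  simp only [← toHom_apply, h]

/-- The inverse extends `φ` to ideals by `I ↦ ∃ a ∈ I, φ a`, the formula forced by `apply_iff`. -/
theorem toHom_surjective : Function.Surjective (toHom (L := L)) := by
  intro φ
  have hmono : ∀ {a b}, a ≤ b → φ a → φ b := fun h => OrderHomClass.mono φ h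
  refine ⟨⟨⟨⟨fun I => ∃ a ∈ I, φ a, fun I J => ?_⟩, ?_⟩, fun s => ?_⟩, ?_⟩
  · refine propext ⟨?_, ?_⟩
    · rintro ⟨a, ha, h⟩
      exact ⟨⟨a, ha.1, h⟩, ⟨a, ha.2, h⟩⟩
    · rintro ⟨⟨a, ha, h⟩, ⟨b, hb, h'⟩⟩
      refine ⟨a ⊓ b, ⟨I.lower inf_le_left ha, J.lower inf_le_right hb⟩, ?_⟩
      rw [map_inf]
      exact ⟨h, h'⟩
  · refine propext ⟨fun _ => trivial, fun _ => ⟨⊤, trivial, ?_⟩⟩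
    rw [map_top]
    trivial
  · refine propext ⟨?_, ?_⟩
    · rintro ⟨a, ha, h⟩
      by_contra hs
      -- If `φ` fails on all elements of all members of `s`, the ideal where `φ` fails is an upper
      -- bound of `s`. This avoids any description of `sSup s` by finite joins.
      let K : Ideal L :=
        { carrier := {x | ¬ φ x}
          lower' := fun x y hyx hx hy => hx (hmono hyx hy)
          nonempty' := ⟨⊥, by simp⟩
          directed' := fun x hx y hy => ⟨x ⊔ y, by
            change ¬ φ (x ⊔ y)
            rw [map_sup]
            exact not_or.2 ⟨hx, hy⟩, le_sup_left, le_sup_right⟩ }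
      have hK : sSup s ≤ K := sSup_le fun I hI x hx hφ =>
        hs ⟨_, ⟨I, hI, rfl⟩, x, hx, hφ⟩
      exact hK ha h
    · intro h
      obtain ⟨_, ⟨I, hI, rfl⟩, a, ha, h⟩ := h
      exact ⟨a, le_sSup hI ha, h⟩
  · refine BoundedLatticeHom.ext fun a => propext ⟨?_, fun h => ⟨a, Ideal.mem_principal_self, h⟩⟩
    rintro ⟨b, hb, h⟩
    exact hmono (Ideal.mem_principal.1 hb) h

/-- The open set of points `p` with `p(↓a) = 1`. -/
def basicSet (a : L) : Set (Locale.PT (Ideal L)) := {p | toHom p a}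

theorem mem_basicSet {a : L} {p : Locale.PT (Ideal L)} : p ∈ basicSet a ↔ toHom p a := Iff.rfl

theorem isOpen_basicSet (a : L) : IsOpen (basicSet a) := ⟨Ideal.principal a, rfl⟩

theorem basicSet_sup (a b : L) : basicSet (a ⊔ b) = basicSet a ∪ basicSet b :=
  Set.ext fun p => iff_of_eq (map_sup (toHom p) a b)

theorem basicSet_inf (a b : L) : basicSet (a ⊓ b) = basicSet a ∩ basicSet b :=
  Set.ext fun p => iff_of_eq (map_inf (toHom p) a b)

theorem basicSet_top : basicSet (⊤ : L) = Set.univ :=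
  Set.ext fun p => iff_of_eq (map_top (toHom p))

theorem basicSet_bot : basicSet (⊥ : L) = ∅ :=
  Set.ext fun p => iff_of_eq (map_bot (toHom p))

theorem isTopologicalBasis : IsTopologicalBasis (Set.range (basicSet (L := L))) := by
  refine isTopologicalBasis_of_isOpen_of_nhds ?_ ?_
  · rintro _ ⟨a, rfl⟩
    exact isOpen_basicSet a
  · rintro p _ hp ⟨I, rfl⟩
    obtain ⟨a, ha, hpa⟩ := (apply_iff p I).1 hp
    exact ⟨_, ⟨a, rfl⟩, hpa, fun q hq => (apply_iff q I).2 ⟨a, ha, hq⟩⟩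

/-- The prime ideal theorem gives a prime ideal `J ⊇ K` avoiding `a`; the point is the indicator of
the complement of `J`. Compactness of basic sets and faithfulness of `a ↦ basicSet a` both rest on
this. -/
theorem exists_point_of_notMem {K : Ideal L} {a : L} (ha : a ∉ K) :
    ∃ p : Locale.PT (Ideal L), p ∈ basicSet a ∧ ∀ b ∈ K, p ∉ basicSet b := by
  obtain ⟨J, hJ, hKJ, hd⟩ := DistribLattice.prime_ideal_of_disjoint_filter_ideal
    (F := PFilter.principal a) (I := K)
    (Set.disjoint_left.2 fun b hb hbK => ha (K.lower (PFilter.mem_principal.1 hb) hbK))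
  obtain ⟨p, hp⟩ := toHom_surjective
    { toFun := fun x => x ∉ J
      map_sup' := fun x y => by
        rw [Ideal.sup_mem_iff, not_and_or]
        rfl
      map_inf' := fun x y => propext
        ⟨fun h => ⟨fun hx => h (J.lower inf_le_left hx), fun hy => h (J.lower inf_le_right hy)⟩,
          fun h hxy => (hJ.mem_or_mem hxy).elim h.1 h.2⟩
      map_top' := eq_true (Ideal.isProper_iff_top_notMem.1 hJ.toIsProper)
      map_bot' := eq_false (not_not.2 J.bot_mem) : BoundedLatticeHom L Prop }
  refine ⟨p, ?_, fun b hb => ?_⟩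
  · rw [mem_basicSet, hp]
    exact Set.disjoint_left.1 hd (PFilter.mem_principal.2 le_rfl)
  · rw [mem_basicSet, hp]
    exact not_not.2 (hKJ hb)

/-- The elements whose basic set is finitely covered form an ideal `K`. If `a ∉ K`, a point of
`basicSet a` lying in no `basicSet b` with `b ∈ K` would still lie in some `U i`, hence in a basic
set inside `U i`, whose index belongs to `K`. -/
theorem isCompact_basicSet (a : L) : IsCompact (basicSet a) := by
  refine isCompact_of_finite_subcover fun {ι} U hU hcov => ?_
  let K : Ideal L :=
    { carrier := {x | ∃ t : Finset ι, basicSet x ⊆ ⋃ i ∈ t, U i}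
      lower' := fun x y hyx ⟨t, ht⟩ =>
        ⟨t, fun p hp => ht (OrderHomClass.mono (toHom p) hyx hp)⟩
      nonempty' := ⟨⊥, ∅, by simp [basicSet_bot]⟩
      directed' := fun x ⟨s, hs⟩ y ⟨t, ht⟩ => ⟨x ⊔ y, by
        classical
        refine ⟨s ∪ t, ?_⟩
        rw [basicSet_sup, Finset.set_biUnion_union]
        exact Set.union_subset_union hs ht, le_sup_left, le_sup_right⟩ }
  by_contra hne
  obtain ⟨p, hpa, hp⟩ := exists_point_of_notMem (K := K) (a := a) hne
  obtain ⟨i, hi⟩ := Set.mem_iUnion.1 (hcov hpa)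
  obtain ⟨_, ⟨b, rfl⟩, hpb, hb⟩ := isTopologicalBasis.exists_subset_of_mem_open hi (hU i)
  exact hp b ⟨{i}, by simpa using hb⟩ hpb

theorem basicSet_subset_iff {a b : L} : basicSet a ⊆ basicSet b ↔ a ≤ b := by
  refine ⟨fun h => ?_, fun h p hp => OrderHomClass.mono (toHom p) h hp⟩
  by_contra hab
  obtain ⟨p, hpa, hp⟩ := exists_point_of_notMem (K := Ideal.principal b) (a := a)
    (fun h => hab (Ideal.mem_principal.1 h))
  exact hp b Ideal.mem_principal_self (h hpa)

theorem exists_basicSet_eq {s : Set (Locale.PT (Ideal L))} (ho : IsOpen s) (hc : IsCompact s) :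
    ∃ a, basicSet a = s := by
  obtain ⟨t, ht, rfl⟩ := (isCompact_open_iff_eq_finite_iUnion_of_isTopologicalBasis
    (basicSet (L := L)) isTopologicalBasis isCompact_basicSet s).1 ⟨hc, ho⟩
  induction t, ht using Set.Finite.induction_on with
  | empty => exact ⟨⊥, by simp [basicSet_bot]⟩
  | @insert a t _ _ ih =>
    have hbi : ⋃ i ∈ insert a t, basicSet i = basicSet a ∪ ⋃ i ∈ t, basicSet i :=
      Set.biUnion_insert a t _
    have ho' : IsOpen (⋃ i ∈ t, basicSet i) := isOpen_biUnion fun i _ => isOpen_basicSet i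
    have hc' : IsCompact (⋃ i ∈ t, basicSet i) :=
      Set.Finite.isCompact_biUnion ‹_› fun i _ => isCompact_basicSet i
    obtain ⟨b, hb⟩ := ih ho' hc'
    exact ⟨a ⊔ b, by rw [basicSet_sup, hb, hbi]⟩

instance : T0Space (Locale.PT (Ideal L)) where
  t0 _ _ h := toHom_injective <| BoundedLatticeHom.ext fun a =>
    propext (h.mem_open_iff (isOpen_basicSet a))

/-- The generic point of an irreducible closed set `Z` is the homomorphism `a ↦ (Z meets basicSet
a)`; irreducibility is exactly what makes it preserve meets and `⊤`. -/
instance : QuasiSober (Locale.PT (Ideal L)) where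
  sober {Z} hZ hcl := by
    obtain ⟨p, hp⟩ := toHom_surjective
      { toFun := fun a : L => (Z ∩ basicSet a).Nonempty
        map_sup' := fun a b => by
          rw [basicSet_sup, Set.inter_union_distrib_left, Set.union_nonempty]
          rfl
        map_inf' := fun a b => propext <| by
          rw [basicSet_inf]
          exact ⟨fun h => ⟨h.mono fun _ hx => ⟨hx.1, hx.2.1⟩, h.mono fun _ hx => ⟨hx.1, hx.2.2⟩⟩,
            fun h => hZ.2 _ _ (isOpen_basicSet a) (isOpen_basicSet b) h.1 h.2⟩
        map_top' := eq_true (by simpa [basicSet_top] using hZ.1)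
        map_bot' := eq_false (by simp [basicSet_bot]) : BoundedLatticeHom L Prop }
    have hmem : ∀ a, p ∈ basicSet a ↔ (Z ∩ basicSet a).Nonempty := fun a => by
      rw [mem_basicSet, hp]
      rfl
    refine ⟨p, Set.ext fun q => ?_⟩
    rw [← hcl.closure_eq, isTopologicalBasis.mem_closure_iff, isTopologicalBasis.mem_closure_iff]
    simp only [Set.forall_mem_range, Set.inter_singleton_nonempty, hmem,
      Set.inter_comm Z]

instance : SpectralSpace (Locale.PT (Ideal L)) where
  isCompact_univ := basicSet_top (L := L) ▸ isCompact_basicSet ⊤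
  inter_isCompact U V hU hU' hV hV' := by
    obtain ⟨a, rfl⟩ := exists_basicSet_eq hU hU'
    obtain ⟨b, rfl⟩ := exists_basicSet_eq hV hV'
    rw [← basicSet_inf]
    exact isCompact_basicSet _
  toPrespectralSpace := .of_isTopologicalBasis' isTopologicalBasis isCompact_basicSet

instance [Small.{w} L] : Small.{w} (Locale.PT (Ideal L)) :=
  small_of_injective (β := Set L) (f := fun p => {a | toHom p a}) fun _ _ h =>
    toHom_injective <| BoundedLatticeHom.ext fun a => congrArg (a ∈ ·) h

end IdealPoints

/-- The space of points of the frame of ideals of a small distributive lattice, as a type in a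
given universe. -/
abbrev IdealSpectrum (L : Type*) [DistribLattice L] [BoundedOrder L] [Small.{w} L] : Type w :=
  Shrink.{w} (Locale.PT (Order.Ideal L))

/-! ### Stone duality for the resized spectrum -/

namespace IdealSpectrum

open IdealPoints

variable {L : Type*} [DistribLattice L] [BoundedOrder L] [Small.{w} L]

variable (L) in
/-- The identification with the space of points of the frame of ideals. -/
def homeo : IdealSpectrum.{w} L ≃ₜ Locale.PT (Order.Ideal L) :=
  (Shrink.homeomorph _).symm

instance : SpectralSpace (IdealSpectrum.{w} L) :=
  have : CompactSpace (IdealSpectrum.{w} L) := (homeo.{w} L).symm.compactSpace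
  (homeo.{w} L).isOpenEmbedding.spectralSpace

variable (L) in
/-- The identification of `L` with the lattice of quasi-compact open subsets. -/
def basic : L ≃o CompactOpens (IdealSpectrum.{w} L) :=
  RelIso.ofSurjective
    (OrderEmbedding.ofMapLEIff (fun a : L =>
      (⟨⟨homeo.{w} L ⁻¹' basicSet a, (homeo.{w} L).isCompact_preimage.2 (isCompact_basicSet a)⟩,
        (isOpen_basicSet a).preimage (homeo.{w} L).continuous⟩ :
          CompactOpens (IdealSpectrum.{w} L)))
      fun _ _ => ((homeo.{w} L).surjective.preimage_subset_preimage_iff).trans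
        basicSet_subset_iff) fun U => by
    obtain ⟨a, ha⟩ := exists_basicSet_eq (s := (homeo.{w} L).symm ⁻¹' U)
      (U.isOpen.preimage (homeo.{w} L).symm.continuous)
      ((homeo.{w} L).symm.isCompact_preimage.2 U.isCompact)
    refine ⟨a, CompactOpens.ext ?_⟩
    change homeo.{w} L ⁻¹' basicSet a = _
    rw [ha, ← Set.preimage_comp, Homeomorph.symm_comp_self]
    rfl

theorem mem_basic (a : L) (x : IdealSpectrum.{w} L) :
    x ∈ basic L a ↔ homeo L x (Order.Ideal.principal a) := Iff.rfl

theorem exists_mem_basic_iff (φ : BoundedLatticeHom L Prop) :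
    ∃ x : IdealSpectrum.{w} L, ∀ a, x ∈ basic L a ↔ φ a := by
  obtain ⟨p, hp⟩ := toHom_surjective φ
  refine ⟨(homeo L).symm p, fun a => ?_⟩
  rw [mem_basic, Homeomorph.apply_symm_apply, ← hp]
  rfl

end IdealSpectrum

/-! ### Spectral maps and homomorphisms of lattices of quasi-compact open subsets -/

theorem SpectralMap.ext_comap {X Y : Type w} [TopologicalSpace X] [TopologicalSpace Y]
    [SpectralSpace Y] {f g : SpectralMap X Y} (h : ∀ U, f.comap U = g.comap U) : f = g := by
  refine SpectralMap.ext fun x => ?_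
  refine (PrespectralSpace.isTopologicalBasis (X := Y)).eq_iff.2 fun s hs => ?_
  exact SetLike.ext_iff.1 (h ⟨⟨s, hs.2⟩, hs.1⟩) x

/-- A homomorphism from `L` to the lattice of quasi-compact open subsets of `X` is induced by a
spectral map from `X` to the spectrum of `L`. -/
theorem IdealSpectrum.exists_comap_basic {L : Type*} [DistribLattice L] [BoundedOrder L]
    [Small.{w} L] {X : Type w} [TopologicalSpace X] [SpectralSpace X]
    (ψ : BoundedLatticeHom L (CompactOpens X)) :
    ∃ f : SpectralMap X (IdealSpectrum.{w} L), ∀ a, f.comap (basic L a) = ψ a := by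
  have h : ∀ x : X, ∃ y : IdealSpectrum.{w} L, ∀ a, y ∈ basic L a ↔ x ∈ ψ a := fun x =>
    exists_mem_basic_iff
      { toFun := fun a => x ∈ ψ a
        map_sup' := fun a b => by
          rw [map_sup]
          rfl
        map_inf' := fun a b => by
          rw [map_inf]
          rfl
        map_top' := by
          rw [map_top]
          rfl
        map_bot' := by
          rw [map_bot]
          rfl }
  choose f hf using h
  have hpre : ∀ a, f ⁻¹' (basic L a : Set (IdealSpectrum.{w} L)) = ψ a := fun a =>
    Set.ext fun x => hf x a
  have hc : ∀ s : Set (IdealSpectrum.{w} L), IsOpen s → IsCompact s →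
      ∃ U : CompactOpens X, f ⁻¹' s = U := fun s ho hc => by
    obtain ⟨a, ha⟩ := (basic L).surjective ⟨⟨s, hc⟩, ho⟩
    exact ⟨ψ a, by rw [← hpre, ha]; rfl⟩
  refine ⟨⟨f, ⟨?_, fun s ho hs => ?_⟩⟩, fun a => CompactOpens.ext (hpre a)⟩
  · refine (PrespectralSpace.isTopologicalBasis (X := IdealSpectrum.{w} L)).continuous_iff.2
      fun s hs => ?_
    obtain ⟨U, hU⟩ := hc s hs.1 hs.2
    exact hU ▸ U.isOpen
  · obtain ⟨U, hU⟩ := hc s ho hs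
    exact hU ▸ U.isCompact

/-! ### Morphisms out of the coproduct of a family -/

namespace EFamily

variable {C : Type u} [Category.{v} C] [HasFiniteCoproducts C] {E : MorphismProperty C}

theorem ι_toBase {X : C} (F : EFamily E X) (i : Fin F.n) :
    Sigma.ι F.obj i ≫ F.toBase = F.hom i :=
  Sigma.ι_desc _ _

theorem p₁_comp_eq_iff [HasPullbacks C] {X Z : C} (F : EFamily E X) (k : (∐ F.obj) ⟶ Z) :
    F.p₁ ≫ k = F.p₂ ≫ k ↔ ∀ i j, pullback.fst (F.hom i) (F.hom j) ≫ Sigma.ι F.obj i ≫ k =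
      pullback.snd (F.hom i) (F.hom j) ≫ Sigma.ι F.obj j ≫ k := by
  refine ⟨fun h i j => ?_, fun h => Sigma.hom_ext _ _ fun ij => ?_⟩
  · have := congrArg (Sigma.ι (fun ij : Fin F.n × Fin F.n =>
      Limits.pullback (F.hom ij.1) (F.hom ij.2)) (i, j) ≫ ·) h
    simpa [p₁, p₂] using this
  · simpa [p₁, p₂] using h ij.1 ij.2

end EFamily

namespace CoherentSite

variable {C : Type u} [Category.{v} C] [HasPullbacks C] [HasFiniteCoproducts C]
  (S : CoherentSite.{v, u} C)

/-! ### Morphisms forcing an element of `Ω₁(R)` -/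

/-- The morphism `h : T ⟶ R` forces `a ∈ Ω₁(R)` if the inverse image of `a` in `Ω₁(T)` is the
greatest element. -/
def Forces {R T : C} (h : T ⟶ R) (a : S.Omega1 R) : Prop :=
  S.omegaMap h a = ⊤

variable {S}

theorem forces_cls {R T : C} {h : T ⟶ R} {F : EFamily S.E R} :
    S.Forces h (S.cls F) ↔ F.pullback h ∈ S.cov T := by
  rw [Forces, omegaMap_cls, top_eq]
  refine ⟨fun hF => ?_, fun hF => ?_⟩
  · exact S.cov_mono _ _ (fun i => ⟨i, rfl⟩) (S.cov_local _ (F.pullback h) (S.cov_unit T)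
      fun _ => S.cls_le_cls.1 hF.ge (0 : Fin 1))
  · exact top_unique (S.cls_le_cls.2 fun _ => S.cov_pullback _ _ hF _ _ _
      fun i => IsPullback.of_hasPullback _ _)

theorem Forces.comp {R T T' : C} {h : T ⟶ R} {a : S.Omega1 R} (H : S.Forces h a) (t : T' ⟶ T) :
    S.Forces (t ≫ h) a := by
  rw [Forces, omegaMap_comp, H, map_top]

theorem forces_comp_iff {R T T' : C} {h : T ⟶ R} {a : S.Omega1 R} (t : T' ⟶ T) :
    S.Forces (t ≫ h) a ↔ S.Forces t (S.omegaMap h a) := by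
  rw [Forces, omegaMap_comp, Forces]

theorem forces_top {R T : C} (h : T ⟶ R) : S.Forces h ⊤ := map_top _

theorem Forces.mono {R T : C} {h : T ⟶ R} {a b : S.Omega1 R} (H : S.Forces h a) (hab : a ≤ b) :
    S.Forces h b :=
  top_unique (H.ge.trans (OrderHomClass.mono (S.omegaMap h) hab))

theorem Forces.inf {R T : C} {h : T ⟶ R} {a b : S.Omega1 R} (H : S.Forces h a)
    (H' : S.Forces h b) : S.Forces h (a ⊓ b) := by
  rw [Forces, map_inf, H, H', inf_top_eq]

theorem forces_of_factor {R T : C} {h : T ⟶ R} {F : EFamily S.E R} (i : Fin F.n)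
    (s : T ⟶ F.obj i) (hs : s ≫ F.hom i = h) : S.Forces h (S.cls F) :=
  forces_cls.2 (S.cov_of_factor h F i s hs)

theorem forces_hom {R : C} (F : EFamily S.E R) (i : Fin F.n) :
    S.Forces (F.hom i) (S.cls F) :=
  forces_of_factor i (𝟙 _) (Category.id_comp _)

theorem cls_le_iff {R : C} {F : EFamily S.E R} {b : S.Omega1 R} :
    S.cls F ≤ b ↔ ∀ i, S.Forces (F.hom i) b := by
  induction b using S.ind with
  | h G => exact S.cls_le_cls.trans (forall_congr' fun i => forces_cls.symm)

/-- It suffices to test the members of a family representing `a`, since each of them forces `a`.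
Identities in `Ω₁(R)` thereby reduce to statements about forcing. -/
theorem le_of_forces {R : C} {a b : S.Omega1 R}
    (h : ∀ {T : C} (h : T ⟶ R), S.Forces h a → S.Forces h b) : a ≤ b := by
  induction a using S.ind with
  | h F => exact cls_le_iff.2 fun i => h _ (forces_hom F i)

/-- Forcing is a local property. -/
theorem Forces.of_cover {R Q T : C} {h : T ⟶ Q} {F : EFamily S.E Q} (hF : S.Forces h (S.cls F))
    {k : T ⟶ R} {b : S.Omega1 R}
    (H : ∀ i, S.Forces (pullback.fst h (F.hom i) ≫ k) b) : S.Forces k b := by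
  induction b using S.ind with
  | h G =>
    exact forces_cls.2 (S.cov_pullback_local k G (F.pullback h) (forces_cls.1 hF)
      fun i => forces_cls.1 (H i))

theorem cls_eq_sup {R : C} (F : EFamily S.E R) :
    S.cls F = Finset.univ.sup fun i => S.cls (EFamily.single (F.hom i) (F.mem i)) := by
  refine le_antisymm (cls_le_iff.2 fun i => ?_) (Finset.sup_le fun i _ => cls_le_iff.2 fun _ => ?_)
  · exact (forces_hom (EFamily.single (F.hom i) (F.mem i)) (0 : Fin 1)).mono
      (Finset.le_sup (f := fun i => S.cls (EFamily.single (F.hom i) (F.mem i)))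
        (Finset.mem_univ i))
  · exact forces_hom F i

/-! ### Descent -/

theorem hom_ext_of_forces {R T Z : C} {h : T ⟶ R} {F : EFamily S.E R}
    (H : S.Forces h (S.cls F)) {f g : T ⟶ Z}
    (hfg : ∀ i, pullback.fst h (F.hom i) ≫ f = pullback.fst h (F.hom i) ≫ g) : f = g := by
  obtain ⟨hc⟩ := S.descent _ (forces_cls.1 H)
  refine Cofork.IsColimit.hom_ext hc (Sigma.hom_ext _ _ fun i => ?_)
  rw [Cofork.π_ofπ, ← Category.assoc, ← Category.assoc, EFamily.ι_toBase]
  exact hfg i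

/-- The `T ×_R Uᵢ` cover `T`, so the morphisms `T ×_R Uᵢ ⟶ Uᵢ ⟶ Z` descend to `T`. The conclusion is
phrased for arbitrary `W` over `T` and `Uᵢ`, so that later uses need no particular fibre product. -/
theorem exists_desc_of_forces {R T Z : C} {h : T ⟶ R} {F : EFamily S.E R}
    (H : S.Forces h (S.cls F)) (z : ∀ i, F.obj i ⟶ Z)
    (hz : ∀ i j, pullback.fst (F.hom i) (F.hom j) ≫ z i =
      pullback.snd (F.hom i) (F.hom j) ≫ z j) :
    ∃ f : T ⟶ Z, ∀ i {W : C} (a : W ⟶ T) (b : W ⟶ F.obj i), a ≫ h = b ≫ F.hom i →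
      a ≫ f = b ≫ z i := by
  obtain ⟨hc⟩ := S.descent _ (forces_cls.1 H)
  let k : (∐ (F.pullback h).obj) ⟶ Z := Sigma.desc fun i => pullback.snd h (F.hom i) ≫ z i
  have hk : (F.pullback h).p₁ ≫ k = (F.pullback h).p₂ ≫ k := by
    refine (EFamily.p₁_comp_eq_iff _ _).2 fun i j => ?_
    rw [Sigma.ι_desc, Sigma.ι_desc]
    -- Double overlaps inside `T` map to the double overlaps `Uᵢ ×_R Uⱼ`, where `hz` applies.
    let l : Limits.pullback (pullback.fst h (F.hom i)) (pullback.fst h (F.hom j)) ⟶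
        Limits.pullback (F.hom i) (F.hom j) :=
      pullback.lift (pullback.fst _ _ ≫ pullback.snd _ _) (pullback.snd _ _ ≫ pullback.snd _ _) (by
        rw [Category.assoc, Category.assoc, ← pullback.condition, ← pullback.condition,
          pullback.condition_assoc])
    have h₂ : l ≫ _ = l ≫ _ := congrArg (l ≫ ·) (hz i j)
    rw [pullback.lift_fst_assoc, pullback.lift_snd_assoc, Category.assoc, Category.assoc] at h₂
    exact h₂
  obtain ⟨f, hf⟩ := Cofork.IsColimit.desc' hc k hk
  refine ⟨f, fun i W a b hab => ?_⟩
  have hi : pullback.fst h (F.hom i) ≫ f = pullback.snd h (F.hom i) ≫ z i :=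
    (congrArg (· ≫ f) (EFamily.ι_toBase (F.pullback h) i)).symm.trans ((Category.assoc _ _ _).trans
      ((congrArg (Sigma.ι (F.pullback h).obj i ≫ ·) hf).trans (Sigma.ι_desc _ _)))
  have h₂ : pullback.lift a b hab ≫ _ = pullback.lift a b hab ≫ _ := congrArg (_ ≫ ·) hi
  rwa [pullback.lift_fst_assoc, pullback.lift_snd_assoc] at h₂

/-- A morphism forcing the class of a single `E`-morphism factors through it. -/
theorem forces_single_iff {R T V : C} {h : T ⟶ R} {f : V ⟶ R} {hf : S.E f} :
    S.Forces h (S.cls (EFamily.single f hf)) ↔ ∃ s : T ⟶ V, s ≫ f = h := by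
  refine ⟨fun H => ?_, fun ⟨s, hs⟩ => forces_of_factor (F := EFamily.single f hf) (0 : Fin 1) s hs⟩
  have := S.mono f hf
  have hfst : pullback.fst f f = pullback.snd f f := by
    rw [← cancel_mono f]
    exact pullback.condition
  -- Since `f` is monic, the two projections of `V ×_R V` coincide, so the identity of `V` is a
  -- descent datum; the descended morphism is the required factorization.
  obtain ⟨s, hs⟩ := exists_desc_of_forces (Z := V) H (fun _ => 𝟙 V)
    fun _ _ => congrArg (· ≫ 𝟙 V) hfst
  refine ⟨s, hom_ext_of_forces H fun i => ?_⟩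
  have hs' : pullback.fst h f ≫ s = pullback.snd h f :=
    (hs (0 : Fin 1) _ _ pullback.condition).trans (Category.comp_id _)
  have : pullback.fst h f ≫ s ≫ f = pullback.fst h f ≫ h := by
    rw [← Category.assoc, hs', pullback.condition]
  exact this

end CoherentSite

namespace CoherentSite

variable {C : Type u} [Category.{v} C] [HasPullbacks C] [HasFiniteCoproducts C]
  {S : CoherentSite.{v, u} C}

/-! ### The object of sections over an element of `Ω₁(R)` -/

/-- A family representing an element of `Ω₁(R)`. -/
def rep {R : C} (a : S.Omega1 R) : EFamily S.E R :=
  Quotient.out a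

theorem cls_rep {R : C} (a : S.Omega1 R) : S.cls (rep a) = a :=
  Quotient.out_eq a

/-- The object of sections over `a ∈ Ω₁(R)`: the coequalizer of `∐ Uᵢ ×_R Uⱼ ⇉ ∐ Uᵢ` for a
representing family `{Uᵢ ⟶ R}`. -/
def sections {R : C} (a : S.Omega1 R) : C :=
  (S.coequalizer (rep a)).choose

/-- The structure morphism of the coequalizer defining `sections a`. -/
def repπ {R : C} (a : S.Omega1 R) : (∐ (rep a).obj) ⟶ sections a :=
  (S.coequalizer (rep a)).choose_spec.choose

theorem repπ_condition {R : C} (a : S.Omega1 R) : (rep a).p₁ ≫ repπ a = (rep a).p₂ ≫ repπ a :=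
  (S.coequalizer (rep a)).choose_spec.choose_spec.choose

/-- The universal property of `sections a` for the chosen representative. -/
def isColimitRep {R : C} (a : S.Omega1 R) :
    IsColimit (Cofork.ofπ (repπ a) (repπ_condition a)) :=
  (S.coequalizer (rep a)).choose_spec.choose_spec.choose_spec.1.some

theorem exists_toSections {R T : C} {a : S.Omega1 R} {h : T ⟶ R} (H : S.Forces h a) :
    ∃ f : T ⟶ sections a, ∀ i {W : C} (s : W ⟶ T) (t : W ⟶ (rep a).obj i),
      s ≫ h = t ≫ (rep a).hom i → s ≫ f = t ≫ Sigma.ι _ i ≫ repπ a :=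
  exists_desc_of_forces (F := rep a) (H.mono (cls_rep a).ge) (fun i => Sigma.ι _ i ≫ repπ a)
    ((EFamily.p₁_comp_eq_iff _ _).1 (repπ_condition a))

/-- The canonical morphism `T ⟶ sections a` associated with a morphism `T ⟶ R` forcing `a`. -/
def toSections {R T : C} {a : S.Omega1 R} (h : T ⟶ R) (H : S.Forces h a) : T ⟶ sections a :=
  (exists_toSections H).choose

theorem comp_toSections_eq {R T W : C} {a : S.Omega1 R} {h : T ⟶ R} (H : S.Forces h a)
    {i : Fin (rep a).n} {s : W ⟶ T} {t : W ⟶ (rep a).obj i} (hst : s ≫ h = t ≫ (rep a).hom i) :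
    s ≫ toSections h H = t ≫ Sigma.ι _ i ≫ repπ a :=
  (exists_toSections H).choose_spec i s t hst

theorem comp_toSections {R T T' : C} {a : S.Omega1 R} {h : T ⟶ R} (H : S.Forces h a)
    (t : T' ⟶ T) : t ≫ toSections h H = toSections (t ≫ h) (H.comp t) := by
  refine hom_ext_of_forces (h := t ≫ h) (F := rep a) ((H.comp t).mono (cls_rep a).ge) fun i => ?_
  rw [← Category.assoc, comp_toSections_eq H (t := pullback.snd _ _),
    comp_toSections_eq (H.comp t) pullback.condition]
  rw [Category.assoc, pullback.condition]

/-- A canonical morphism into `sections a` depends only on the composite to `R`. This is the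
standard way below to compare two local constructions on an overlap. -/
theorem comp_toSections_congr {R T T' W : C} {a : S.Omega1 R} {h : T ⟶ R} {h' : T' ⟶ R}
    (H : S.Forces h a) (H' : S.Forces h' a) {t : W ⟶ T} {t' : W ⟶ T'} (e : t ≫ h = t' ≫ h') :
    t ≫ toSections h H = t' ≫ toSections h' H' := by
  simp only [comp_toSections, e]

theorem toSections_rep {R : C} (a : S.Omega1 R) (i : Fin (rep a).n)
    (H : S.Forces ((rep a).hom i) a) :
    toSections ((rep a).hom i) H = Sigma.ι _ i ≫ repπ a := by
  simpa using comp_toSections_eq H (s := 𝟙 _) (t := 𝟙 ((rep a).obj i)) rfl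

theorem forces_hom_of_eq {R : C} {a : S.Omega1 R} {F : EFamily S.E R} (hF : S.cls F = a)
    (i : Fin F.n) : S.Forces (F.hom i) a :=
  hF ▸ forces_hom F i

/-- Each member of the chosen representative is covered by its fibre products with the members of
`F`, and on these the canonical morphism factors through a member of `F`. -/
theorem sections_hom_ext {R Z : C} {a : S.Omega1 R} {F : EFamily S.E R} (hF : S.cls F = a)
    {f g : sections a ⟶ Z}
    (h : ∀ i, toSections (F.hom i) (forces_hom_of_eq hF i) ≫ f =
      toSections (F.hom i) (forces_hom_of_eq hF i) ≫ g) : f = g := by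
  refine Cofork.IsColimit.hom_ext (isColimitRep a) (Sigma.hom_ext _ _ fun i => ?_)
  have H : S.Forces ((rep a).hom i) a := forces_hom_of_eq (cls_rep a) i
  rw [Cofork.π_ofπ, ← Category.assoc, ← Category.assoc, ← toSections_rep a i H]
  refine hom_ext_of_forces (F := F) (H.mono hF.ge) fun j => ?_
  rw [← Category.assoc, ← Category.assoc,
    comp_toSections_congr H (forces_hom_of_eq hF j) pullback.condition,
    Category.assoc, Category.assoc, h]

theorem sections_hom_ext' {R Z : C} {a : S.Omega1 R} {f g : sections a ⟶ Z}
    (h : ∀ {T : C} (k : T ⟶ R) (H : S.Forces k a),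
      toSections k H ≫ f = toSections k H ≫ g) : f = g :=
  sections_hom_ext (cls_rep a) fun _ => h _ _

theorem exists_sections_desc {R Z : C} {a : S.Omega1 R} {F : EFamily S.E R} (hF : S.cls F = a)
    (z : ∀ i, F.obj i ⟶ Z)
    (hz : ∀ i j, pullback.fst (F.hom i) (F.hom j) ≫ z i =
      pullback.snd (F.hom i) (F.hom j) ≫ z j) :
    ∃ m : sections a ⟶ Z, ∀ i, toSections (F.hom i) (forces_hom_of_eq hF i) ≫ m = z i := by
  have H : ∀ i, S.Forces ((rep a).hom i) a := forces_hom_of_eq (cls_rep a)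
  -- The datum on `F` is first descended to the members of the chosen representative, which force
  -- `S.cls F`, and only then to the coequalizer.
  choose y hy using fun i => exists_desc_of_forces ((H i).mono hF.ge) z hz
  have hc : (rep a).p₁ ≫ Sigma.desc y = (rep a).p₂ ≫ Sigma.desc y := by
    refine (EFamily.p₁_comp_eq_iff _ _).2 fun i j => ?_
    rw [Sigma.ι_desc, Sigma.ι_desc]
    refine hom_ext_of_forces (F := F) (h := pullback.fst ((rep a).hom i) ((rep a).hom j) ≫ _)
      (((H i).comp _).mono hF.ge) fun k => ?_
    rw [← Category.assoc, ← Category.assoc, hy i k _ (pullback.snd _ _) 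
      ((Category.assoc _ _ _).trans pullback.condition), hy j k _ (pullback.snd _ _) (by
        rw [Category.assoc, ← pullback.condition (f := (rep a).hom i)]
        exact pullback.condition)]
  obtain ⟨m, hm⟩ := Cofork.IsColimit.desc' (isColimitRep a) _ hc
  rw [Cofork.π_ofπ] at hm
  have hm' : ∀ i, toSections _ (H i) ≫ m = y i := fun i => by
    rw [toSections_rep, Category.assoc, hm, Sigma.ι_desc]
  refine ⟨m, fun j => ?_⟩
  have hj := forces_hom_of_eq hF j
  refine hom_ext_of_forces (F := rep a) (hj.mono (cls_rep a).ge) fun i => ?_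
  rw [← Category.assoc, comp_toSections_congr hj (H i) pullback.condition, Category.assoc, hm',
    hy i j _ _ pullback.condition.symm]

/-- `sections a` is a coequalizer of `∐ Uᵢ ×_R Uⱼ ⇉ ∐ Uᵢ` for every family representing `a`. -/
theorem sections_isColimit {R : C} {a : S.Omega1 R} {F : EFamily S.E R} (hF : S.cls F = a)
    (π : (∐ F.obj) ⟶ sections a)
    (hπ : ∀ i, Sigma.ι F.obj i ≫ π = toSections (F.hom i) (forces_hom_of_eq hF i))
    (h : F.p₁ ≫ π = F.p₂ ≫ π) : Nonempty (IsColimit (Cofork.ofπ π h)) := by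
  have key : ∀ s : Cofork F.p₁ F.p₂, ∃ m : sections a ⟶ s.pt, π ≫ m = s.π := fun s => by
    obtain ⟨m, hm⟩ := exists_sections_desc hF (fun i => Sigma.ι F.obj i ≫ s.π)
      ((EFamily.p₁_comp_eq_iff _ _).1 s.condition)
    refine ⟨m, Sigma.hom_ext _ _ fun i => ?_⟩
    rw [← Category.assoc, hπ, hm]
  refine ⟨Cofork.IsColimit.mk _ (fun s => (key s).choose) (fun s => (key s).choose_spec) ?_⟩
  intro s m hm
  refine sections_hom_ext hF fun i => ?_
  rw [← hπ, Category.assoc, Category.assoc, (key s).choose_spec]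
  exact congrArg _ hm

/-- With `sections_hom_ext'`, this exhibits `sections a` as the colimit of all `T ⟶ R` forcing `a`,
free of any choice of family. -/
theorem exists_sections_desc_of_natural {R Z : C} {a : S.Omega1 R}
    (z : ∀ {T : C} (h : T ⟶ R), S.Forces h a → (T ⟶ Z))
    (hz : ∀ {T T' : C} (t : T' ⟶ T) (h : T ⟶ R) (H : S.Forces h a),
      t ≫ z h H = z (t ≫ h) (H.comp t)) :
    ∃ m : sections a ⟶ Z, ∀ {T : C} (h : T ⟶ R) (H : S.Forces h a),
      toSections h H ≫ m = z h H := by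
  have H' := forces_hom_of_eq (cls_rep a)
  obtain ⟨m, hm⟩ := exists_sections_desc (cls_rep a) (fun i => z _ (H' i)) fun i j => by
    simp only [hz, pullback.condition]
  refine ⟨m, fun h H => hom_ext_of_forces (F := rep a) (H.mono (cls_rep a).ge) fun i => ?_⟩
  rw [← Category.assoc, comp_toSections_congr H (H' i) pullback.condition, Category.assoc, hm]
  simp only [hz, pullback.condition]

theorem exists_proj {R : C} (a : S.Omega1 R) :
    ∃ q : sections a ⟶ R, ∀ {T : C} (h : T ⟶ R) (H : S.Forces h a), toSections h H ≫ q = h :=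
  exists_sections_desc_of_natural (fun h _ => h) fun _ _ _ => rfl

/-- The canonical morphism `sections a ⟶ R`. -/
def proj {R : C} (a : S.Omega1 R) : sections a ⟶ R :=
  (exists_proj a).choose

theorem toSections_proj {R T : C} {a : S.Omega1 R} (h : T ⟶ R) (H : S.Forces h a) :
    toSections h H ≫ proj a = h :=
  (exists_proj a).choose_spec h H

theorem exists_sectionsMap {R : C} {a b : S.Omega1 R} (hab : a ≤ b) :
    ∃ m : sections a ⟶ sections b, ∀ {T : C} (h : T ⟶ R) (H : S.Forces h a),
      toSections h H ≫ m = toSections h (H.mono hab) :=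
  exists_sections_desc_of_natural (fun h H => toSections h (H.mono hab))
    fun _ _ _ => comp_toSections _ _

/-- The morphism `sections a ⟶ sections b` for `a ≤ b`. -/
def sectionsMap {R : C} {a b : S.Omega1 R} (hab : a ≤ b) : sections a ⟶ sections b :=
  (exists_sectionsMap hab).choose

theorem toSections_map {R T : C} {a b : S.Omega1 R} (hab : a ≤ b) (h : T ⟶ R)
    (H : S.Forces h a) : toSections h H ≫ sectionsMap hab = toSections h (H.mono hab) :=
  (exists_sectionsMap hab).choose_spec h H

theorem sectionsMap_comp {R : C} {a b c : S.Omega1 R} (hab : a ≤ b) (hbc : b ≤ c) :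
    sectionsMap hab ≫ sectionsMap hbc = sectionsMap (hab.trans hbc) := by
  refine sections_hom_ext' fun h H => ?_
  rw [← Category.assoc, toSections_map, toSections_map, toSections_map]

theorem sectionsMap_proj {R : C} {a b : S.Omega1 R} (hab : a ≤ b) :
    sectionsMap hab ≫ proj b = proj a := by
  refine sections_hom_ext' fun h H => ?_
  rw [← Category.assoc, toSections_map, toSections_proj, toSections_proj]

/-- The functor `a ↦ sections a`. -/
def sectionsFunctor (S : CoherentSite.{v, u} C) (R : C) : S.Omega1 R ⥤ C where
  obj a := sections a
  map f := sectionsMap (leOfHom f)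
  map_id a := sections_hom_ext' fun h H => by rw [toSections_map, Category.comp_id]
  map_comp f g := (sectionsMap_comp _ _).symm

theorem proj_toSections {R : C} {a : S.Omega1 R} (H : S.Forces (𝟙 R) a) :
    proj a ≫ toSections (𝟙 R) H = 𝟙 _ :=
  sections_hom_ext' fun h H => by
    rw [← Category.assoc, toSections_proj, comp_toSections]
    simp only [Category.comp_id]

/-! ### The sheaf condition -/

/-- A finite join is represented by one family, each member of which lies over a single `a i`;
gluing over the `a i` thus becomes descent for that family. -/
theorem exists_family_sup {R : C} {ι : Type*} (a : ι → S.Omega1 R) (t : Finset ι) :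
    ∃ G : EFamily S.E R, S.cls G = t.sup a ∧ ∀ k, ∃ i, S.Forces (G.hom k) (a i) := by
  classical
  induction t using Finset.induction_on with
  | empty => exact ⟨EFamily.empty S.E R, rfl, fun k => k.elim0⟩
  | insert i t _ ih =>
    obtain ⟨G, hG, hGa⟩ := ih
    refine ⟨(rep (a i)).union G, ?_, EFamily.union_forall
      (p := fun _ h => ∃ j, S.Forces h (a j))
      (fun k => ⟨i, forces_hom_of_eq (cls_rep _) k⟩) hGa⟩
    rw [← cls_sup_cls, cls_rep, hG, Finset.sup_insert]

theorem sections_hom_ext_sup {R Z : C} {n : ℕ} (a : Fin n → S.Omega1 R) {b : S.Omega1 R}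
    (hb : Finset.univ.sup a = b) (hab : ∀ i, a i ≤ b) {f g : sections b ⟶ Z}
    (h : ∀ i, sectionsMap (hab i) ≫ f = sectionsMap (hab i) ≫ g) : f = g := by
  obtain ⟨G, hG, hGa⟩ := exists_family_sup a Finset.univ
  refine sections_hom_ext (hG.trans hb) fun k => ?_
  obtain ⟨i, hi⟩ := hGa k
  rw [← toSections_map (hab i) _ hi, Category.assoc, Category.assoc, h]

theorem exists_sections_glue {R Z : C} {n : ℕ} (a : Fin n → S.Omega1 R) {b : S.Omega1 R}
    (hb : Finset.univ.sup a = b) (hab : ∀ i, a i ≤ b) (z : ∀ i, sections (a i) ⟶ Z)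
    (hz : ∀ i j, sectionsMap (inf_le_left : a i ⊓ a j ≤ a i) ≫ z i =
      sectionsMap (inf_le_right : a i ⊓ a j ≤ a j) ≫ z j) :
    ∃ m : sections b ⟶ Z, ∀ i, sectionsMap (hab i) ≫ m = z i := by
  -- A morphism forcing both `a i` and `a j` forces their meet, so both composites pass through
  -- `sections (a i ⊓ a j)`, where `hz` compares them.
  have hz' : ∀ i j {T : C} (h : T ⟶ R) (Hi : S.Forces h (a i)) (Hj : S.Forces h (a j)),
      toSections h Hi ≫ z i = toSections h Hj ≫ z j := fun i j T h Hi Hj => by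
    rw [← toSections_map inf_le_left h (Hi.inf Hj), ← toSections_map inf_le_right h (Hi.inf Hj),
      Category.assoc, Category.assoc, hz]
  obtain ⟨G, hG, hGa⟩ := exists_family_sup a Finset.univ
  -- The index attached to each member is arbitrary; `hz'` makes the resulting morphism independent
  -- of it.
  choose i hi using hGa
  obtain ⟨m, hm⟩ := exists_sections_desc (hG.trans hb)
    (fun k => toSections (G.hom k) (hi k) ≫ z (i k)) fun k l => by
      rw [← Category.assoc, ← Category.assoc, comp_toSections, comp_toSections,
        hz' _ (i l) _ _ (pullback.condition (f := G.hom k) (g := G.hom l) ▸ (hi l).comp _)]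
      simp only [pullback.condition]
  refine ⟨m, fun j => sections_hom_ext' fun h H => ?_⟩
  rw [← Category.assoc, toSections_map]
  refine hom_ext_of_forces (F := G) ((H.mono (hab j)).mono (hG.trans hb).ge) fun k => ?_
  rw [← Category.assoc, comp_toSections_congr (H.mono (hab j)) (forces_hom_of_eq (hG.trans hb) k)
    pullback.condition, Category.assoc, hm, ← Category.assoc, ← Category.assoc, comp_toSections,
    comp_toSections, hz' _ j _ _ (pullback.condition (f := h) (g := G.hom k) ▸ H.comp _)]
  simp only [pullback.condition]

/-! ### The support -/

/-- Both sides are forced by the same `k`. Because the `g i` are canonical, a local lift of `k ≫ h`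
to some `Uᵢ ×_{sections a} V` is a local factorization of `k ≫ toSections h H` through `V`, and
conversely. -/
theorem omegaMap_cls_along {R T V : C} {a : S.Omega1 R} {F : EFamily S.E R} (hF : S.cls F = a)
    (g : ∀ i, F.obj i ⟶ sections a) (hg : ∀ i, g i = toSections _ (forces_hom_of_eq hF i))
    (f : V ⟶ sections a) (hf : S.E f) (h : T ⟶ R) (H : S.Forces h a) :
    S.omegaMap h (S.cls (F.along g f hf)) =
      S.omegaMap (toSections h H) (S.cls (EFamily.single f hf)) := by
  refine le_antisymm (le_of_forces fun k hk => ?_) (le_of_forces fun k hk => ?_)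
  · rw [← forces_comp_iff] at hk ⊢
    have e : ∀ (i : Fin F.n) {W : C} (p : W ⟶ _) (q : W ⟶ Limits.pullback (g i) f),
        p ≫ k ≫ h = q ≫ pullback.fst (g i) f ≫ F.hom i →
          (q ≫ pullback.snd (g i) f) ≫ f = p ≫ k ≫ toSections h H := fun i W p q hpq => by
      rw [Category.assoc, ← pullback.condition, ← Category.assoc, ← Category.assoc]
      refine (congrArg (_ ≫ ·) (hg i)).trans (comp_toSections_congr _ _ ?_)
      rw [Category.assoc, Category.assoc, hpq]
    exact Forces.of_cover hk fun i => forces_single_iff.2 ⟨_, e i _ _ pullback.condition⟩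
  · rw [← forces_comp_iff] at hk ⊢
    obtain ⟨s, hs⟩ := forces_single_iff.1 hk
    refine Forces.of_cover (F := F) ((H.comp k).mono hF.ge) fun i => ?_
    refine forces_of_factor (F := F.along g f hf) i
      (pullback.lift (pullback.snd (k ≫ h) (F.hom i)) (pullback.fst (k ≫ h) (F.hom i) ≫ s) ?_) ?_
    · rw [Category.assoc, hs, hg i, ← Category.assoc]
      refine comp_toSections_congr _ _ ?_
      rw [Category.assoc]
      exact pullback.condition.symm
    · exact (pullback.lift_fst_assoc _ _ _ _).trans pullback.condition.symm

theorem cls_along_le {R A V : C} (F : EFamily S.E R) (g : ∀ i, F.obj i ⟶ A) (f : V ⟶ A)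
    (hf : S.E f) : S.cls (F.along g f hf) ≤ S.cls F :=
  S.cls_le_cls_of_factor fun i => ⟨i, pullback.fst _ _, rfl⟩

/-- A general `b` is a finite join of classes of single `E`-morphisms, for which `EFamily.along` is
the answer; inverse images preserve joins. -/
theorem exists_supp {R : C} (a : S.Omega1 R) (b : S.Omega1 (sections a)) :
    ∃ c ≤ a, ∀ {T : C} (h : T ⟶ R) (H : S.Forces h a),
      S.omegaMap h c = S.omegaMap (toSections h H) b := by
  induction b using S.ind with
  | h G =>
    let g : ∀ i, (rep a).obj i ⟶ sections a := fun i =>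
      toSections _ (forces_hom_of_eq (cls_rep a) i)
    refine ⟨Finset.univ.sup fun k => S.cls ((rep a).along g (G.hom k) (G.mem k)),
      Finset.sup_le fun k _ => (cls_along_le _ _ _ _).trans (cls_rep a).le, fun h H => ?_⟩
    rw [cls_eq_sup G, map_finset_sup, map_finset_sup]
    exact Finset.sup_congr rfl fun k _ => omegaMap_cls_along (cls_rep a) g (fun _ => rfl) _ _ h H

/-- The support in `Ω₁(R)` of an element of `Ω₁(sections a)`. -/
def supp {R : C} (a : S.Omega1 R) (b : S.Omega1 (sections a)) : S.Omega1 R :=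
  (exists_supp a b).choose

theorem supp_le {R : C} (a : S.Omega1 R) (b : S.Omega1 (sections a)) : supp a b ≤ a :=
  (exists_supp a b).choose_spec.1

theorem omegaMap_supp {R T : C} {a : S.Omega1 R} (b : S.Omega1 (sections a)) (h : T ⟶ R)
    (H : S.Forces h a) : S.omegaMap h (supp a b) = S.omegaMap (toSections h H) b :=
  (exists_supp a b).choose_spec.2 h H

/-- Both candidates lie below `a`, so any morphism forcing one of them forces `a` and the two can be
compared after base change along it. -/
theorem supp_eq_of {R : C} {a c : S.Omega1 R} {b : S.Omega1 (sections a)} (hc : c ≤ a)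
    (h : ∀ {T : C} (h : T ⟶ R) (H : S.Forces h a),
      S.omegaMap h c = S.omegaMap (toSections h H) b) : supp a b = c := by
  refine le_antisymm (le_of_forces fun k hk => ?_) (le_of_forces fun k hk => ?_)
  · have H := hk.mono (supp_le a b)
    rwa [Forces, h k H, ← omegaMap_supp]
  · have H := hk.mono hc
    rwa [Forces, omegaMap_supp b k H, ← h]

theorem supp_cls_single {R V : C} {a : S.Omega1 R} {F : EFamily S.E R} (hF : S.cls F = a)
    (g : ∀ i, F.obj i ⟶ sections a) (hg : ∀ i, g i = toSections _ (forces_hom_of_eq hF i))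
    (f : V ⟶ sections a) (hf : S.E f) :
    supp a (S.cls (EFamily.single f hf)) = S.cls (F.along g f hf) :=
  supp_eq_of ((cls_along_le F g f hf).trans hF.le) (omegaMap_cls_along hF g hg f hf)

theorem supp_sup {R : C} (a : S.Omega1 R) (b c : S.Omega1 (sections a)) :
    supp a (b ⊔ c) = supp a b ⊔ supp a c :=
  supp_eq_of (sup_le (supp_le a b) (supp_le a c)) fun h H => by
    rw [map_sup, map_sup, omegaMap_supp, omegaMap_supp]

theorem supp_inf {R : C} (a : S.Omega1 R) (b c : S.Omega1 (sections a)) :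
    supp a (b ⊓ c) = supp a b ⊓ supp a c :=
  supp_eq_of (inf_le_left.trans (supp_le a b)) fun h H => by
    rw [map_inf, map_inf, omegaMap_supp, omegaMap_supp]

theorem supp_top {R : C} (a : S.Omega1 R) : supp a ⊤ = a :=
  supp_eq_of le_rfl fun h H => by rw [map_top, H]

theorem supp_bot {R : C} (a : S.Omega1 R) : supp a ⊥ = ⊥ :=
  supp_eq_of bot_le fun h H => by rw [map_bot, map_bot]

theorem supp_map {R : C} {a' a : S.Omega1 R} (h : a' ≤ a) (b : S.Omega1 (sections a)) :
    supp a' (S.omegaMap (sectionsMap h) b) = supp a b ⊓ a' :=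
  supp_eq_of inf_le_right fun k H => by
    rw [map_inf, H, inf_top_eq, ← omegaMap_comp, toSections_map, omegaMap_supp]

theorem supp_proj {R : C} (a c : S.Omega1 R) :
    supp a (S.omegaMap (proj a) c) = c ⊓ a :=
  supp_eq_of inf_le_right fun k H => by
    rw [map_inf, H, inf_top_eq, ← omegaMap_comp, toSections_proj]

/-- Any `k` forcing `a'` forces the support, which says that `toSections k` factors through `A`. As
`j` is monic these factorizations are unique, hence natural, and assemble to a morphism out of
`sections a'`. -/
theorem exists_factor_of_le_supp {R A : C} {a' a : S.Omega1 R} (h : a' ≤ a) (j : A ⟶ sections a)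
    (hj : S.E j) (hle : a' ≤ supp a (S.cls (EFamily.single j hj))) :
    ∃ g : sections a' ⟶ A, g ≫ j = sectionsMap h := by
  have := S.mono j hj
  have key : ∀ {T : C} (k : T ⟶ R) (H : S.Forces k a'),
      ∃ s : T ⟶ A, s ≫ j = toSections k (H.mono h) := fun k H => by
    refine (forces_single_iff (hf := hj)).1 ?_
    rw [Forces, ← omegaMap_supp]
    exact H.mono hle
  obtain ⟨g, hg⟩ := exists_sections_desc_of_natural (fun k H => (key k H).choose) fun t k H => by
    rw [← cancel_mono j, Category.assoc, (key k H).choose_spec,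
      (key (t ≫ k) (H.comp t)).choose_spec,
      comp_toSections]
  refine ⟨g, sections_hom_ext' fun k H => ?_⟩
  rw [← Category.assoc, hg, (key k H).choose_spec, toSections_map]

/-- For an `E`-morphism `f : V ⟶ R`, the canonical morphism from `V` to the sections over `{f}` is
an isomorphism. -/
theorem isIso_toSections_single {R V : C} (f : V ⟶ R) (hf : S.E f) {a : S.Omega1 R}
    (ha : S.cls (EFamily.single f hf) = a) (H : S.Forces f a) : IsIso (toSections f H) := by
  subst ha
  have := S.mono f hf
  have key : ∀ {T : C} (k : T ⟶ R) (_ : S.Forces k (S.cls (EFamily.single f hf))),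
      ∃ s : T ⟶ V, s ≫ f = k := fun k H => forces_single_iff.1 H
  obtain ⟨r, hr⟩ := exists_sections_desc_of_natural (fun k H => (key k H).choose) fun t k H => by
    rw [← cancel_mono f, Category.assoc, (key k H).choose_spec,
      (key (t ≫ k) (H.comp t)).choose_spec]
  refine ⟨r, ?_, sections_hom_ext' fun k H' => ?_⟩
  · rw [hr, ← cancel_mono f, (key f H).choose_spec, Category.id_comp]
  · rw [← Category.assoc, hr, comp_toSections, Category.comp_id]
    simp only [(key k H').choose_spec]

end CoherentSite

/-! ### Gluing morphisms out of a `Cᵒᵖ`-valued sheaf -/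

namespace IsOpSheaf

variable {C : Type u} [Category.{v} C] [HasFiniteCoproducts C]
  {X : Type w} [TopologicalSpace X] [SpectralSpace X] {O : CompactOpens X ⥤ C}

theorem hom_ext (hO : IsOpSheaf O) {n : ℕ} {W : Fin n → CompactOpens X} {V : CompactOpens X}
    (hV : Finset.univ.sup W = V) (hW : ∀ i, W i ≤ V) {Z : C} {f g : O.obj V ⟶ Z}
    (h : ∀ i, O.map (homOfLE (hW i)) ≫ f = O.map (homOfLE (hW i)) ≫ g) : f = g := by
  subst hV
  obtain ⟨_, ⟨hc⟩⟩ := hO n W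
  refine Cofork.IsColimit.hom_ext hc (Sigma.hom_ext _ _ fun i => ?_)
  rw [Cofork.π_ofπ, Sigma.ι_desc_assoc, Sigma.ι_desc_assoc]
  exact h i

theorem exists_glue (hO : IsOpSheaf O) {n : ℕ} {W : Fin n → CompactOpens X} {V : CompactOpens X}
    (hV : Finset.univ.sup W = V) (hW : ∀ i, W i ≤ V) {Z : C} (z : ∀ i, O.obj (W i) ⟶ Z)
    (hz : ∀ i j, O.map (homOfLE (inf_le_left : W i ⊓ W j ≤ W i)) ≫ z i =
      O.map (homOfLE (inf_le_right : W i ⊓ W j ≤ W j)) ≫ z j) :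
    ∃ m : O.obj V ⟶ Z, ∀ i, O.map (homOfLE (hW i)) ≫ m = z i := by
  subst hV
  obtain ⟨_, ⟨hc⟩⟩ := hO n W
  obtain ⟨m, hm⟩ := Cofork.IsColimit.desc' hc (Sigma.desc z) (Sigma.hom_ext _ _ fun ij => by
    simpa using hz ij.1 ij.2)
  refine ⟨m, fun i => ?_⟩
  have : Sigma.ι (fun i => O.obj (W i)) i ≫ _ = Sigma.ι (fun i => O.obj (W i)) i ≫ _ :=
    congrArg (Sigma.ι (fun i => O.obj (W i)) i ≫ ·) hm
  rw [Cofork.π_ofπ, Sigma.ι_desc_assoc, Sigma.ι_desc] at this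
  exact this

theorem of_glue
    (hext : ∀ {n : ℕ} (W : Fin n → CompactOpens X) {Z : C}
      (f g : O.obj (Finset.univ.sup W) ⟶ Z),
      (∀ i, O.map (homOfLE (Finset.le_sup (f := W) (Finset.mem_univ i))) ≫ f =
        O.map (homOfLE (Finset.le_sup (f := W) (Finset.mem_univ i))) ≫ g) → f = g)
    (hglue : ∀ {n : ℕ} (W : Fin n → CompactOpens X) {Z : C} (z : ∀ i, O.obj (W i) ⟶ Z),
      (∀ i j, O.map (homOfLE (inf_le_left : W i ⊓ W j ≤ W i)) ≫ z i =
        O.map (homOfLE (inf_le_right : W i ⊓ W j ≤ W j)) ≫ z j) →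
      ∃ m : O.obj (Finset.univ.sup W) ⟶ Z,
        ∀ i, O.map (homOfLE (Finset.le_sup (f := W) (Finset.mem_univ i))) ≫ m = z i) :
    IsOpSheaf O := by
  intro n W
  refine ⟨Sigma.hom_ext _ _ fun ij => ?_, ⟨?_⟩⟩
  · simp only [Sigma.ι_desc_assoc, Category.assoc, Sigma.ι_desc, ← Functor.map_comp]
    rfl
  · refine Cofork.IsColimit.mk' _ fun s => ?_
    have hs : ∀ i j, O.map (homOfLE (inf_le_left : W i ⊓ W j ≤ W i)) ≫
        Sigma.ι (fun i => O.obj (W i)) i ≫ s.π =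
        O.map (homOfLE (inf_le_right : W i ⊓ W j ≤ W j)) ≫
          Sigma.ι (fun i => O.obj (W i)) j ≫ s.π := fun i j => by
      have := congrArg (Sigma.ι (fun ij : Fin n × Fin n => O.obj (W ij.1 ⊓ W ij.2)) (i, j) ≫ ·)
        s.condition
      simpa using this
    have key := hglue W (fun i => Sigma.ι (fun i => O.obj (W i)) i ≫ s.π) hs
    refine ⟨key.choose, Sigma.hom_ext _ _ fun i => ?_, fun {m} hm => hext W _ _ fun i => ?_⟩
    · rw [Cofork.π_ofπ, Sigma.ι_desc_assoc]
      exact key.choose_spec i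
    · rw [key.choose_spec, ← hm, Cofork.π_ofπ, Sigma.ι_desc_assoc]

end IsOpSheaf

/-! ### The spectrum -/

namespace CoherentSite

variable {C : Type u} [Category.{v} C] [HasPullbacks C] [HasFiniteCoproducts C]
  {S : CoherentSite.{v, u} C}

section Spectrum

variable (S) (R : C) [Small.{w} (S.Omega1 R)]

/-- The identification of `Ω₁(R)` with the lattice of quasi-compact open subsets of the
spectrum. -/
abbrev basicOpen : S.Omega1 R ≃o CompactOpens (IdealSpectrum.{w} (S.Omega1 R)) :=
  IdealSpectrum.basic (S.Omega1 R)

/-- The structure sheaf of the spectrum. -/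
abbrev structureSheaf : CompactOpens (IdealSpectrum.{w} (S.Omega1 R)) ⥤ C :=
  (basicOpen.{w} S R).symm.monotone.functor ⋙ sectionsFunctor S R

theorem structureSheaf_isOpSheaf : IsOpSheaf (structureSheaf.{w} S R) := by
  refine IsOpSheaf.of_glue (fun W Z f g h => ?_) (fun W Z z hz => ?_)
  · exact sections_hom_ext_sup (fun i => (basicOpen S R).symm (W i))
      (map_finset_sup (basicOpen S R).symm Finset.univ W).symm
      (fun i => (basicOpen S R).symm.monotone (Finset.le_sup (f := W) (Finset.mem_univ i))) h
  · let a : Fin _ → S.Omega1 R := fun i => (basicOpen S R).symm (W i)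
    let z' : ∀ i, sections (a i) ⟶ Z := z
    refine exists_sections_glue a (map_finset_sup (basicOpen S R).symm Finset.univ W).symm
      (fun i => (basicOpen S R).symm.monotone (Finset.le_sup (f := W) (Finset.mem_univ i))) z'
      fun i j => ?_
    -- The order isomorphism respects meets only up to a propositional equality, so the sections
    -- over the two forms of the meet are compared by a restriction map.
    have h : a i ⊓ a j ≤ (basicOpen S R).symm (W i ⊓ W j) :=
      (map_inf (basicOpen S R).symm _ _).ge
    have hl : (basicOpen S R).symm (W i ⊓ W j) ≤ a i :=
      (basicOpen S R).symm.monotone inf_le_left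
    have hr : (basicOpen S R).symm (W i ⊓ W j) ≤ a j :=
      (basicOpen S R).symm.monotone inf_le_right
    have hz' : sectionsMap hl ≫ z' i = sectionsMap hr ≫ z' j := hz i j
    rw [← sectionsMap_comp h hl, ← sectionsMap_comp h hr, Category.assoc, Category.assoc, hz']

/-- The support morphism of the spectrum. -/
def supportHom (U : CompactOpens (IdealSpectrum.{w} (S.Omega1 R))) :
    BoundedLatticeHom (S.Omega1 ((structureSheaf S R).obj U)) (Set.Iic U) where
  toFun b := ⟨basicOpen S R (supp _ b),
    (OrderIso.le_symm_apply _).1 (supp_le ((basicOpen S R).symm U) b)⟩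
  map_sup' b c := Subtype.ext <| (congrArg _ (supp_sup _ b c)).trans (map_sup _ _ _)
  map_inf' b c := Subtype.ext <| (congrArg _ (supp_inf _ b c)).trans (map_inf _ _ _)
  map_top' := Subtype.ext <| (congrArg _ (supp_top _)).trans (OrderIso.apply_symm_apply _ _)
  map_bot' := Subtype.ext <| (congrArg _ (supp_bot _)).trans (map_bot _)

/-- The spectrum of `R`. -/
def spec : WeakScheme.{w} S where
  carrier := IdealSpectrum.{w} (S.Omega1 R)
  sheaf := structureSheaf S R
  isOpSheaf := structureSheaf_isOpSheaf S R
  support := supportHom S R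
  support_map {V _} h b :=
    (congrArg _ (supp_map ((basicOpen S R).symm.monotone h) b)).trans
      ((map_inf _ _ _).trans (congrArg _ ((basicOpen S R).apply_symm_apply V)))
  factor h _ j hj hV :=
    exists_factor_of_le_supp ((basicOpen S R).symm.monotone h) j hj
      ((OrderIso.symm_apply_le _).2 hV)

theorem forces_basicOpen {F : EFamily S.E R} (i : Fin F.n) :
    S.Forces (F.hom i) ((basicOpen.{w} S R).symm (basicOpen.{w} S R (S.cls F))) :=
  forces_hom_of_eq ((basicOpen S R).symm_apply_apply _).symm i

/-- The coequalizer diagrams presenting the sections of the structure sheaf of the spectrum. -/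
def specπ (F : EFamily S.E R) :
    (∐ F.obj) ⟶ (spec.{w} S R).sheaf.obj (basicOpen S R (S.cls F)) :=
  Sigma.desc fun i => toSections (F.hom i) (forces_basicOpen S R i)

theorem ι_specπ (F : EFamily S.E R) (i : Fin F.n) :
    Sigma.ι F.obj i ≫ specπ.{w} S R F = toSections (F.hom i) (forces_basicOpen S R i) :=
  Sigma.ι_desc _ _

theorem specπ_condition (F : EFamily S.E R) :
    F.p₁ ≫ specπ.{w} S R F = F.p₂ ≫ specπ.{w} S R F := by
  refine (EFamily.p₁_comp_eq_iff _ _).2 fun i j => ?_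
  rw [ι_specπ, ι_specπ]
  exact comp_toSections_congr _ _ pullback.condition

/-- The presentation of `spec S R` as the spectrum of `R`. -/
def spectrumData : SpectrumData S R (spec.{w} S R) where
  homeo := IdealSpectrum.homeo (S.Omega1 R)
  basic := basicOpen S R
  mem_basic _ _ := Iff.rfl
  π := specπ S R
  condition := specπ_condition S R
  isColimit F := (sections_isColimit ((basicOpen S R).symm_apply_apply _).symm _
    (ι_specπ S R F) _).some
  π_map F G h i j := by
    have key : ∀ i, Sigma.ι F.obj i ≫ specπ.{w} S R F ≫
        (spec.{w} S R).sheaf.map (homOfLE ((basicOpen S R).monotone h)) =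
        toSections (F.hom i) ((forces_basicOpen S R i).mono
          ((basicOpen S R).symm.monotone ((basicOpen S R).monotone h))) := fun i => by
      rw [← Category.assoc, ι_specπ]
      exact toSections_map ((basicOpen S R).symm.monotone ((basicOpen S R).monotone h)) _ _
    rw [key, ι_specπ]
    exact comp_toSections_congr _ _ pullback.condition
  support_basic F V f hf := congrArg (basicOpen S R)
    (supp_cls_single ((basicOpen S R).symm_apply_apply _).symm _ (ι_specπ S R F) f hf)

end Spectrum

end CoherentSite

namespace WeakScheme

open CoherentSite

variable {C : Type u} [Category.{v} C] [HasPullbacks C] [HasFiniteCoproducts C]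
  {S : CoherentSite.{v, u} C}

/-! ### Morphisms to a spectrum -/

section Lift

variable {X : WeakScheme.{w} S} {R : C} (g : X.sheaf.obj ⊤ ⟶ R)

/-- The morphism `𝒪(W) ⟶ R` obtained from `Γ(X) ⟶ R`. -/
def structureMap (W : CompactOpens X.carrier) : X.sheaf.obj W ⟶ R :=
  X.sheaf.map (homOfLE le_top) ≫ g

theorem map_structureMap {W V : CompactOpens X.carrier} (h : W ≤ V) :
    X.sheaf.map (homOfLE h) ≫ structureMap g V = structureMap g W := by
  rw [structureMap, ← Category.assoc, ← Functor.map_comp]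
  rfl

theorem structureMap_top : structureMap g ⊤ = g :=
  (congrArg (· ≫ g) (X.sheaf.map_id ⊤)).trans (Category.id_comp g)

/-- The lattice homomorphism `Ω₁(R) ⟶ Ω_c(X)` induced by `Γ(X) ⟶ R` and the support morphism. -/
def inverseImage : BoundedLatticeHom (S.Omega1 R) (CompactOpens X.carrier) where
  toFun a := (X.support ⊤ (S.omegaMap g a) : CompactOpens X.carrier)
  map_sup' a b := by
    rw [map_sup, map_sup]
    rfl
  map_inf' a b := by
    rw [map_inf, map_inf]
    rfl
  map_top' := by
    rw [map_top, map_top]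
    rfl
  map_bot' := by
    rw [map_bot, map_bot]
    rfl

theorem support_structureMap (W : CompactOpens X.carrier) (a : S.Omega1 R) :
    (X.support W (S.omegaMap (structureMap g W) a) : CompactOpens X.carrier) =
      inverseImage g a ⊓ W := by
  rw [structureMap, omegaMap_comp, X.support_map]
  rfl

/-- The factorization axiom concerns `E`-morphisms into `Γ(X)`; it is applied to the base change of
`f` along `g`. -/
theorem exists_factor_structureMap {V : C} (f : V ⟶ R) (hf : S.E f)
    {W : CompactOpens X.carrier} (hW : W ≤ inverseImage g (S.cls (EFamily.single f hf))) :
    ∃ t : X.sheaf.obj W ⟶ V, t ≫ f = structureMap g W := by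
  obtain ⟨t, ht⟩ := X.factor le_top (pullback.fst g f)
    (S.E.of_isPullback (IsPullback.of_hasPullback _ _).flip hf) hW
  refine ⟨t ≫ pullback.snd g f, ?_⟩
  rw [Category.assoc, ← pullback.condition, ← Category.assoc, ht, structureMap]

theorem sup_inverseImage_rep (a : S.Omega1 R) :
    (Finset.univ.sup fun i => inverseImage g
      (S.cls (EFamily.single ((rep a).hom i) ((rep a).mem i)))) = inverseImage g a := by
  conv_rhs => rw [← cls_rep a, cls_eq_sup, map_finset_sup]
  rfl

theorem inverseImage_rep_le (a : S.Omega1 R) (i : Fin (rep a).n) :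
    inverseImage g (S.cls (EFamily.single ((rep a).hom i) ((rep a).mem i))) ≤
      inverseImage g a :=
  OrderHomClass.mono (inverseImage g) (cls_le_iff.2 fun _ => forces_hom_of_eq (cls_rep a) i)

/-- Morphisms out of the sections over the inverse image of `a` can be compared locally. -/
theorem inverseImage_hom_ext {a : S.Omega1 R} {V : CompactOpens X.carrier}
    (hV : V = inverseImage g a) {Z : C} {f f' : X.sheaf.obj V ⟶ Z}
    (h : ∀ {W : CompactOpens X.carrier} {T : C} (hW : W ≤ V) (k : T ⟶ R) (_ : S.Forces k a)
      (t : X.sheaf.obj W ⟶ T), t ≫ k = structureMap g W →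
      X.sheaf.map (homOfLE hW) ≫ f = X.sheaf.map (homOfLE hW) ≫ f') : f = f' := by
  subst hV
  refine X.isOpSheaf.hom_ext (sup_inverseImage_rep g a) (inverseImage_rep_le g a) fun i => ?_
  obtain ⟨t, ht⟩ := exists_factor_structureMap g ((rep a).hom i) ((rep a).mem i) le_rfl
  exact h _ _ (forces_hom_of_eq (cls_rep a) i) t ht

/-- Open subsets of the inverse image of `a` can be compared locally. -/
theorem inverseImage_ext {a : S.Omega1 R} {V P Q : CompactOpens X.carrier}
    (hV : V = inverseImage g a) (hP : P ≤ V) (hQ : Q ≤ V)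
    (h : ∀ {W : CompactOpens X.carrier} {T : C} (_ : W ≤ V) (k : T ⟶ R) (_ : S.Forces k a)
      (t : X.sheaf.obj W ⟶ T), t ≫ k = structureMap g W → P ⊓ W = Q ⊓ W) : P = Q := by
  subst hV
  rw [← inf_eq_left.2 hP, ← inf_eq_left.2 hQ, ← sup_inverseImage_rep g a,
    Finset.sup_inf_distrib_left, Finset.sup_inf_distrib_left]
  refine Finset.sup_congr rfl fun i _ => ?_
  obtain ⟨t, ht⟩ := exists_factor_structureMap g ((rep a).hom i) ((rep a).mem i) le_rfl
  exact h (inverseImage_rep_le g a i) _ (forces_hom_of_eq (cls_rep a) i) t ht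

/-- The morphism `m : 𝒪(V) ⟶ sections a` is induced by `g`, i.e. it is compatible with all local
factorizations of `g`. -/
def IsInduced (a : S.Omega1 R) (V : CompactOpens X.carrier) (m : X.sheaf.obj V ⟶ sections a) :
    Prop :=
  ∀ ⦃W : CompactOpens X.carrier⦄ ⦃T : C⦄ (hW : W ≤ V) (h : T ⟶ R) (H : S.Forces h a)
    (t : X.sheaf.obj W ⟶ T), t ≫ h = structureMap g W →
    X.sheaf.map (homOfLE hW) ≫ m = t ≫ toSections h H

variable {g}

theorem IsInduced.of_rep {a : S.Omega1 R} {V : CompactOpens X.carrier}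
    (hV : V = inverseImage g a) {m : X.sheaf.obj V ⟶ sections a}
    (hm : ∀ (i : Fin (rep a).n) (hW : inverseImage g
        (S.cls (EFamily.single ((rep a).hom i) ((rep a).mem i))) ≤ V)
      (t : X.sheaf.obj (inverseImage g
        (S.cls (EFamily.single ((rep a).hom i) ((rep a).mem i)))) ⟶ (rep a).obj i),
      t ≫ (rep a).hom i = structureMap g _ →
      X.sheaf.map (homOfLE hW) ≫ m = t ≫ toSections _ (forces_hom_of_eq (cls_rep a) i)) :
    IsInduced g a V m := by
  subst hV
  intro W T hW h H t ht
  let W' : Fin (rep a).n → CompactOpens X.carrier := fun i =>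
    inverseImage g (S.cls (EFamily.single ((rep a).hom i) ((rep a).mem i)))
  -- `W` is cut into pieces on which both the given factorization `t` and one through a member of
  -- the representative are available.
  have hsup : (Finset.univ.sup fun i => W ⊓ W' i) = W := by
    rw [← Finset.sup_inf_distrib_left, sup_inverseImage_rep, inf_eq_left.2 hW]
  refine X.isOpSheaf.hom_ext hsup (fun i => inf_le_left) fun i => ?_
  obtain ⟨s, hs⟩ := exists_factor_structureMap g ((rep a).hom i) ((rep a).mem i) le_rfl
  have h₁ : X.sheaf.map (homOfLE (inf_le_left : W ⊓ W' i ≤ W)) ≫ X.sheaf.map (homOfLE hW) ≫ m =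
      X.sheaf.map (homOfLE (inf_le_right : W ⊓ W' i ≤ W' i)) ≫
        X.sheaf.map (homOfLE (inverseImage_rep_le g a i)) ≫ m := by
    rw [← Category.assoc, ← Category.assoc, ← Functor.map_comp, ← Functor.map_comp]
    rfl
  rw [h₁, hm i _ s hs, ← Category.assoc, ← Category.assoc]
  refine comp_toSections_congr _ _ ?_
  rw [Category.assoc, Category.assoc, hs, ht, map_structureMap, map_structureMap]

/-- The local factorizations `𝒪(Wᵢ) ⟶ Uᵢ ⟶ sections a` agree on overlaps because their composites to
`R` do, and `𝒪` is a sheaf. -/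
theorem exists_isInduced {a : S.Omega1 R} {V : CompactOpens X.carrier}
    (hV : V = inverseImage g a) : ∃ m : X.sheaf.obj V ⟶ sections a, IsInduced g a V m := by
  choose t ht using fun i : Fin (rep a).n =>
    exists_factor_structureMap g ((rep a).hom i) ((rep a).mem i) le_rfl
  have hF := forces_hom_of_eq (cls_rep a)
  obtain ⟨m, hm⟩ := X.isOpSheaf.exists_glue (sup_inverseImage_rep g a)
    (inverseImage_rep_le g a) (fun i => t i ≫ toSections _ (hF i)) fun i j => by
      rw [← Category.assoc, ← Category.assoc]
      refine comp_toSections_congr _ _ ?_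
      rw [Category.assoc, Category.assoc, ht, ht, map_structureMap, map_structureMap]
  subst hV
  refine ⟨m, IsInduced.of_rep rfl fun i hW s hs => ?_⟩
  rw [hm i]
  exact comp_toSections_congr _ _ ((ht i).trans hs.symm)

theorem IsInduced.unique {a : S.Omega1 R} {V : CompactOpens X.carrier}
    (hV : V = inverseImage g a) {m m' : X.sheaf.obj V ⟶ sections a} (hm : IsInduced g a V m)
    (hm' : IsInduced g a V m') : m = m' :=
  inverseImage_hom_ext g hV fun hW k H t ht => by rw [hm hW k H t ht, hm' hW k H t ht]

theorem IsInduced.naturality {a b : S.Omega1 R} {V V' : CompactOpens X.carrier} (hab : a ≤ b)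
    (hV : V = inverseImage g a) (hVV' : V ≤ V') {m : X.sheaf.obj V ⟶ sections a}
    {m' : X.sheaf.obj V' ⟶ sections b} (hm : IsInduced g a V m) (hm' : IsInduced g b V' m') :
    X.sheaf.map (homOfLE hVV') ≫ m' = m ≫ sectionsMap hab := by
  refine inverseImage_hom_ext g hV fun {W T} hW k H t ht => ?_
  rw [← Category.assoc, ← Category.assoc, hm hW k H t ht, Category.assoc t, toSections_map,
    ← hm' (hW.trans hVV') k (H.mono hab) t ht, ← Functor.map_comp]
  rfl

/-- Locally `m` is `t` followed by `toSections k`, and the defining property of `supp` moves the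
inverse image of `b` back to `R`. -/
theorem IsInduced.support {a : S.Omega1 R} {V : CompactOpens X.carrier}
    (hV : V = inverseImage g a) {m : X.sheaf.obj V ⟶ sections a} (hm : IsInduced g a V m)
    (b : S.Omega1 (sections a)) :
    (X.support V (S.omegaMap m b) : CompactOpens X.carrier) = inverseImage g (supp a b) := by
  refine inverseImage_ext g hV (X.support V _).2
    ((OrderHomClass.mono (inverseImage g) (supp_le a b)).trans hV.ge) fun {W T} hW k H t ht => ?_
  rw [← X.support_map hW, ← omegaMap_comp, hm hW k H t ht, omegaMap_comp, ← omegaMap_supp b k H,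
    ← omegaMap_comp, ht, support_structureMap]

variable [Small.{w} (S.Omega1 R)]

variable (g) in
/-- The morphism `φ : X ⟶ spec S R` is the one corresponding to `g : Γ(X) ⟶ R`. -/
structure IsLift (φ : X ⟶ spec.{w} S R) : Prop where
  comap : ∀ U : CompactOpens (spec.{w} S R).carrier,
    φ.base.comap U = inverseImage g ((basicOpen S R).symm U)
  app : ∀ U : CompactOpens (spec.{w} S R).carrier,
    IsInduced g ((basicOpen S R).symm U) (φ.base.comap U) (φ.app U)

variable (g) in
theorem exists_isLift : ∃ φ : X ⟶ spec.{w} S R, IsLift g φ := by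
  obtain ⟨f, hf⟩ := IdealSpectrum.exists_comap_basic.{w} (inverseImage g)
  have hf' : ∀ U : CompactOpens (spec.{w} S R).carrier,
      f.comap U = inverseImage g ((basicOpen S R).symm U) := fun U => by
    rw [← hf]
    exact congrArg f.comap ((basicOpen S R).apply_symm_apply U).symm
  choose app happ using fun U => exists_isInduced (hf' U)
  exact ⟨
    { base := f
      app := app
      naturality := fun {V U} h =>
        IsInduced.naturality ((basicOpen S R).symm.monotone h) (hf' V) (f.comap_mono h)
          (happ V) (happ U)
      support_app := fun U a => ((happ U).support (hf' U) a).trans (hf _).symm }, hf', happ⟩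

theorem IsLift.unique {φ φ' : X ⟶ spec.{w} S R} (h : IsLift g φ) (h' : IsLift g φ') : φ = φ' := by
  obtain ⟨f, app, _, _⟩ := φ
  obtain ⟨f', app', _, _⟩ := φ'
  obtain rfl : f = f' :=
    SpectralMap.ext_comap fun U => (h.comap U).trans (h'.comap U).symm
  exact Hom.ext rfl (heq_of_eq (funext fun U => (h.app U).unique (h.comap U) (h'.app U)))

/-! ### Every morphism to the spectrum is the lift of its transpose -/

variable (S R) in
/-- The canonical morphism `Γ(Spec R) ⟶ R`. -/
def specProj : (spec.{w} S R).sheaf.obj ⊤ ⟶ R :=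
  proj ((basicOpen S R).symm ⊤)

/-- The morphism `Γ(X) ⟶ R` corresponding to `φ : X ⟶ spec S R`. -/
def transpose (φ : X ⟶ spec.{w} S R) : X.sheaf.obj ⊤ ⟶ R :=
  X.sheaf.map (homOfLE (show ⊤ ≤ φ.base.comap ⊤ from fun _ h => h)) ≫ φ.app ⊤ ≫ specProj S R

theorem map_comp_specProj (φ : X ⟶ spec.{w} S R) :
    (Γ S).map φ ≫ specProj S R = transpose φ :=
  Category.assoc _ _ _

theorem IsLift.transpose_eq {φ : X ⟶ spec.{w} S R} (h : IsLift g φ) : transpose φ = g := by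
  have H : S.Forces g ((basicOpen.{w} S R).symm ⊤) := by
    rw [map_top]
    exact forces_top g
  -- Since `g` forces `⊤`, it is itself an admissible local factorization over the whole space, with
  -- `t` the identity.
  have h₁ := h.app ⊤ (W := ⊤) (fun _ hx => hx) g H (𝟙 _)
    ((Category.id_comp g).trans (structureMap_top g).symm)
  refine (Category.assoc _ _ _).symm.trans ((congrArg (· ≫ specProj S R) h₁).trans ?_)
  exact (Category.assoc _ _ _).trans ((Category.id_comp _).trans (toSections_proj g H))

theorem app_proj (φ : X ⟶ spec.{w} S R) (U : CompactOpens (spec.{w} S R).carrier) :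
    φ.app U ≫ proj ((basicOpen S R).symm U) = structureMap (transpose φ) (φ.base.comap U) := by
  have h₁ := φ.naturality (le_top : U ≤ ⊤)
  have h₂ : sectionsMap ((basicOpen.{w} S R).symm.monotone (le_top : U ≤ ⊤)) ≫ specProj S R = _ :=
    sectionsMap_proj _
  refine (congrArg (φ.app U ≫ ·) h₂).symm.trans ?_
  refine (Category.assoc _ _ _).symm.trans ((congrArg (· ≫ specProj S R) h₁).symm.trans ?_)
  rw [structureMap, transpose, ← Category.assoc (X.sheaf.map _), ← Functor.map_comp]
  exact Category.assoc _ _ _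

/-- The inverse image of `a` under `Γ(Spec R) ⟶ R` has support `a` (`supp_proj`), so compatibility
of `φ` with supports on global sections determines all inverse images. -/
theorem comap_basicOpen (φ : X ⟶ spec.{w} S R) (a : S.Omega1 R) :
    φ.base.comap (basicOpen S R a) = inverseImage (transpose φ) a := by
  have h₁ := φ.support_app ⊤ (S.omegaMap (specProj S R) a)
  have h₂ := X.support_map (show ⊤ ≤ φ.base.comap ⊤ from fun _ h => h)
    (S.omegaMap (φ.app ⊤) (S.omegaMap (specProj S R) a))
  have h₃ : supp ((basicOpen.{w} S R).symm ⊤) (S.omegaMap (specProj S R) a) = a :=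
    (supp_proj _ a).trans (by rw [map_top, inf_top_eq])
  rw [inf_top_eq, h₁, ← omegaMap_comp, ← omegaMap_comp] at h₂
  exact (congrArg (fun b => φ.base.comap (basicOpen S R b)) h₃).symm.trans (h₂.symm.trans
    (congrArg (fun k => (X.support ⊤ (S.omegaMap k a) : CompactOpens X.carrier))
      (Category.assoc _ _ _)))

theorem comap_eq (φ : X ⟶ spec.{w} S R) (U : CompactOpens (spec.{w} S R).carrier) :
    φ.base.comap U = inverseImage (transpose φ) ((basicOpen S R).symm U) :=
  (congrArg φ.base.comap ((basicOpen S R).apply_symm_apply U).symm).trans (comap_basicOpen φ _)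

variable (S) in
theorem forces_basicOpen_single {V : C} (f : V ⟶ R) (hf : S.E f) :
    S.Forces f ((basicOpen.{w} S R).symm (basicOpen.{w} S R (S.cls (EFamily.single f hf)))) :=
  forces_basicOpen S R (F := EFamily.single f hf) (0 : Fin 1)

instance isIso_toSections_basicOpen {V : C} (f : V ⟶ R) (hf : S.E f) :
    IsIso (toSections f (forces_basicOpen_single.{w} S f hf)) :=
  isIso_toSections_single f hf ((basicOpen.{w} S R).symm_apply_apply _).symm _

theorem inv_toSections_comp {V : C} (f : V ⟶ R) (hf : S.E f) :
    inv (toSections f (forces_basicOpen_single.{w} S f hf)) ≫ f = proj _ := by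
  rw [IsIso.inv_comp_eq, toSections_proj]

/-- Over the basic open set of `f` the sections are `V`, and `V ⟶ R` is monic. The component of `φ`
there is therefore determined by its composite to `R`, known from `app_proj`; naturality carries the
result to `U`. -/
theorem map_app_eq (φ : X ⟶ spec.{w} S R) {V : C} (f : V ⟶ R) (hf : S.E f)
    {U : CompactOpens (spec.{w} S R).carrier} (H : S.Forces f ((basicOpen S R).symm U))
    {W : CompactOpens X.carrier}
    (hW : W ≤ inverseImage (transpose φ) (S.cls (EFamily.single f hf)))
    (hWU : W ≤ φ.base.comap U) (t : X.sheaf.obj W ⟶ V)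
    (ht : t ≫ f = structureMap (transpose φ) W) :
    X.sheaf.map (homOfLE hWU) ≫ φ.app U = t ≫ toSections f H := by
  have := S.mono f hf
  have ha : S.cls (EFamily.single f hf) ≤ (basicOpen S R).symm U := cls_le_iff.2 fun _ => H
  have hU : basicOpen S R (S.cls (EFamily.single f hf)) ≤ U := (OrderIso.le_symm_apply _).1 ha
  let r : X.sheaf.obj W ⟶
      sections ((basicOpen.{w} S R).symm (basicOpen.{w} S R (S.cls (EFamily.single f hf)))) :=
    X.sheaf.map (homOfLE (hW.trans (comap_basicOpen φ _).ge)) ≫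
      φ.app (basicOpen S R (S.cls (EFamily.single f hf)))
  have hr : r ≫ inv (toSections f (forces_basicOpen_single.{w} S f hf)) = t := by
    rw [← cancel_mono f, ht, Category.assoc, inv_toSections_comp]
    exact (Category.assoc _ _ _).trans
      ((congrArg (_ ≫ ·) (app_proj φ _)).trans (map_structureMap _ _))
  have h₁ : X.sheaf.map (homOfLE hWU) ≫ φ.app U =
      r ≫ sectionsMap ((basicOpen.{w} S R).symm.monotone hU) := by
    refine Eq.trans ?_ (Category.assoc _ _ _).symm
    refine Eq.trans ?_ (congrArg (_ ≫ ·) (φ.naturality hU))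
    rw [← Category.assoc, ← Functor.map_comp]
    rfl
  refine h₁.trans ?_
  rw [← hr, Category.assoc,
    ← toSections_map ((basicOpen.{w} S R).symm.monotone hU) f (forces_basicOpen_single.{w} S f hf),
    IsIso.inv_hom_id_assoc]

theorem isLift_transpose (φ : X ⟶ spec.{w} S R) : IsLift (transpose φ) φ :=
  ⟨comap_eq φ, fun U => IsInduced.of_rep (comap_eq φ U) fun i hW t ht =>
    map_app_eq φ _ ((rep _).mem i) _ le_rfl hW t ht⟩

variable (X R) in
/-- The bijection between morphisms `Γ(X) ⟶ R` and morphisms `X ⟶ Spec R`. -/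
def homEquiv : ((Γ S).obj X ⟶ R) ≃ (X ⟶ spec.{w} S R) where
  toFun g := (exists_isLift g).choose
  invFun φ := transpose φ
  left_inv g := (exists_isLift g).choose_spec.transpose_eq
  right_inv φ := (exists_isLift _).choose_spec.unique (isLift_transpose φ)

theorem isLift_homEquiv (g : (Γ S).obj X ⟶ R) : IsLift g (homEquiv X R g) :=
  (exists_isLift g).choose_spec

theorem homEquiv_symm_apply (φ : X ⟶ spec.{w} S R) :
    (homEquiv X R).symm φ = (Γ S).map φ ≫ specProj S R :=
  (map_comp_specProj φ).symm

theorem homEquiv_symm_id : (homEquiv _ R).symm (𝟙 (spec.{w} S R)) = specProj S R := by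
  rw [homEquiv_symm_apply, (Γ S).map_id]
  exact Category.id_comp _

end Lift

/-! ### The functor, the adjunction and its counit -/

section Functor

theorem IsLift.isInducedBy {A B : C} [Small.{w} (S.Omega1 A)] [Small.{w} (S.Omega1 B)]
    {f : A ⟶ B} {φ : spec.{w} S A ⟶ spec.{w} S B} (h : IsLift (specProj S A ≫ f) φ) :
    (spectrumData S A).IsInducedBy (spectrumData S B) f φ := by
  intro F
  have hcomap : φ.base.comap (basicOpen S B (S.cls F)) =
      basicOpen S A (S.cls (F.pullback f)) := by
    refine (h.comap _).trans ?_
    rw [OrderIso.symm_apply_apply]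
    change basicOpen S A (supp _ (S.omegaMap (specProj S A ≫ f) _)) = _
    rw [omegaMap_comp]
    exact congrArg _ ((supp_proj _ _).trans
      ((congrArg (_ ⊓ ·) (map_top (basicOpen.{w} S A).symm)).trans (inf_top_eq _)))
  refine ⟨hcomap, fun i => ?_⟩
  let k : Limits.pullback f (F.hom i) ⟶ A := pullback.fst f (F.hom i)
  have hk : S.E k := (F.pullback f).mem i
  have hW : basicOpen S A (S.cls (EFamily.single k hk)) ≤
      basicOpen S A (S.cls (F.pullback f)) :=
    (basicOpen S A).monotone (cls_le_iff.2 fun _ => forces_hom (F.pullback f) i)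
  let j := toSections k (forces_basicOpen_single.{w} S k hk)
  have hj : IsIso j := isIso_toSections_basicOpen k hk
  -- On its own basic open set, `A ×_B Uᵢ` is the object of sections via `j`; so the second
  -- projection becomes a local factorization through `Uᵢ`, to which the lifting property of `φ`
  -- applies.
  let t := inv j ≫ pullback.snd f (F.hom i)
  have hjt : j ≫ t = pullback.snd f (F.hom i) := IsIso.hom_inv_id_assoc _ _
  have ht : t ≫ F.hom i =
      proj ((basicOpen.{w} S A).symm (basicOpen.{w} S A (S.cls (EFamily.single k hk)))) ≫ f := by
    rw [Category.assoc, ← pullback.condition, ← Category.assoc, inv_toSections_comp]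
  have h₁ := h.app (basicOpen S B (S.cls F)) (hW.trans hcomap.ge) (F.hom i)
    (forces_basicOpen S B i) t (ht.trans (Eq.trans (congrArg (· ≫ f)
      (sectionsMap_proj ((basicOpen.{w} S A).symm.monotone le_top)).symm) (Category.assoc _ _ _)))
  have h₂ : Sigma.ι (F.pullback f).obj i ≫ specπ S A (F.pullback f) =
      j ≫ (spec.{w} S A).sheaf.map (homOfLE hW) :=
    (ι_specπ S A (F.pullback f) i).trans
      (toSections_map ((basicOpen S A).symm.monotone hW) k _).symm
  refine (Category.assoc _ _ _).symm.trans ((congrArg (· ≫ _) h₂).trans ?_)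
  refine Eq.trans ?_ (congrArg (_ ≫ ·) (ι_specπ S B F i)).symm
  refine (Category.assoc _ _ _).trans (Eq.trans (congrArg (j ≫ ·) (Eq.trans ?_ h₁)) ?_)
  · exact (Category.assoc _ _ _).symm.trans (congrArg (· ≫ φ.app _)
      ((spec S A).sheaf.map_comp (homOfLE hW) (homOfLE hcomap.ge)).symm)
  · exact (Category.assoc _ _ _).symm.trans (congrArg (· ≫ toSections _ _) hjt)

variable (S) [∀ R : C, Small.{w} (S.Omega1 R)]

/-- Only the inverse bijection has an explicit formula, `φ ↦ Γ(φ) ≫ specProj`, so naturality is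
checked there. -/
theorem homEquiv_naturality (X' X : WeakScheme.{w} S) (R : C) (f : X' ⟶ X)
    (g : (Γ S).obj X ⟶ R) :
    homEquiv X' R ((Γ S).map f ≫ g) = f ≫ homEquiv X R g := by
  apply (homEquiv X' R).symm.injective
  rw [Equiv.symm_apply_apply, homEquiv_symm_apply, Functor.map_comp]
  exact (congrArg ((Γ S).map f ≫ ·) (((homEquiv X R).symm_apply_apply g).symm.trans
    (homEquiv_symm_apply _))).trans (Category.assoc _ _ _).symm

/-- The functor `Spec`. -/
def specFunctor : C ⥤ WeakScheme.{w} S :=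
  Adjunction.rightAdjointOfEquiv (fun X R => homEquiv X R) (homEquiv_naturality S)

/-- The adjunction between global sections and `Spec`. -/
def specAdjunction : Γ.{w} S ⊣ specFunctor.{w} S :=
  Adjunction.adjunctionOfEquivRight (fun X R => homEquiv X R) (homEquiv_naturality S)

theorem specAdjunction_counit_app (R : C) :
    (specAdjunction.{w} S).counit.app R = specProj S R :=
  (Adjunction.adjunctionOfEquivRight_counit_app _ _ R).trans homEquiv_symm_id

theorem isLift_specFunctor_map {A B : C} (f : A ⟶ B) :
    IsLift (specProj S A ≫ f) ((specFunctor.{w} S).map f) := by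
  have h : (specFunctor.{w} S).map f =
      homEquiv (spec S A) B ((homEquiv _ A).symm (𝟙 (spec.{w} S A)) ≫ f) := rfl
  rw [h, homEquiv_symm_id]
  exact isLift_homEquiv _

theorem canonical_eq (R : C) (H : S.Forces (𝟙 R) ((basicOpen.{w} S R).symm ⊤)) :
    (spectrumData.{w} S R).canonical = toSections (𝟙 R) H := by
  refine (Category.assoc _ _ _).symm.trans ((congrArg (· ≫ _)
    (ι_specπ.{w} S R (EFamily.unit S.E R) (0 : Fin 1))).trans ?_)
  exact toSections_map ((basicOpen S R).symm.monotone le_top) _ _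

end Functor

end WeakScheme

end

theorem mainTheorem4 {C : Type u} [Category.{v} C] [HasPullbacks C] [HasFiniteCoproducts C]
    (S : CoherentSite.{v, u} C) [∀ R : C, Small.{w} (S.Omega1 R)] :
    ∃ (Spec : C ⥤ WeakScheme.{w} S) (adj : WeakScheme.Γ.{w} S ⊣ Spec)
      (D : ∀ R : C, SpectrumData S R (Spec.obj R)),
      (∀ {A B : C} (f : A ⟶ B), (D A).IsInducedBy (D B) f (Spec.map f)) ∧
      (∀ R : C, IsIso (D R).canonical ∧ (D R).canonical ≫ adj.counit.app R = 𝟙 R) ∧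
      Spec.Full ∧ Spec.Faithful := by
  have H : ∀ R : C, S.Forces (𝟙 R) ((S.basicOpen.{w} R).symm ⊤) := fun R => by
    rw [map_top]
    exact CoherentSite.forces_top _
  have h₁ : ∀ R : C, (S.spectrumData.{w} R).canonical ≫ WeakScheme.specProj S R = 𝟙 R := by
    intro R
    rw [WeakScheme.canonical_eq S R (H R)]
    exact CoherentSite.toSections_proj _ _
  have h₂ : ∀ R : C, WeakScheme.specProj S R ≫ (S.spectrumData.{w} R).canonical = 𝟙 _ := by
    intro R
    rw [WeakScheme.canonical_eq S R (H R)]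
    exact CoherentSite.proj_toSections _
  -- The counit is `specProj`, with `canonical` as two-sided inverse; a right adjoint with
  -- invertible counit is fully faithful.
  have hc : ∀ R : C, IsIso ((WeakScheme.specAdjunction.{w} S).counit.app R) := fun R => by
    rw [WeakScheme.specAdjunction_counit_app]
    exact ⟨_, h₂ R, h₁ R⟩
  have := NatIso.isIso_of_isIso_app (WeakScheme.specAdjunction.{w} S).counit
  have hf := (WeakScheme.specAdjunction.{w} S).fullyFaithfulROfIsIsoCounit
  refine ⟨WeakScheme.specFunctor S, WeakScheme.specAdjunction S, fun R => S.spectrumData R,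
    fun f => (WeakScheme.isLift_specFunctor_map S f).isInducedBy,
    fun R => ⟨⟨_, h₁ R, h₂ R⟩, ?_⟩, hf.full, hf.faithful⟩
  rw [WeakScheme.specAdjunction_counit_app]
  exact h₁ R
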